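/- Let $q$ be a complex-valued summable function on $[0,1]$, put $q_n=\int_0^1 q(x)e^{-i2n\pi x}\,dx$ for $n\in\mathbb Z$ and assume $q_0=0$. Write $(f,e^{i2n\pi x})=\int_0^1 f(x)e^{-i2n\pi x}\,dx$. Let $L$ be the operator in $L_2[0,1]$ generated by $-y''+qy$ with the periodic boundary conditions $y(1)=y(0)$, $y'(1)=y'(0)$. For $m\ge 1$ let $$\rho(m)=\max\Big\{\sup_{0\le x\le1}\Big|\int_0^x q(t)e^{-i4m\pi t}\,dt\Big|,\ \sup_{0\le x\le1}\Big|\int_0^x q(t)e^{i4m\pi t}\,dt\Big|\Big\}.$$ For large $m$ let $\lambda_{m,1},\lambda_{m,2}$ be the periodic eigenvalues of $L$ close to $(2m\pi)^2$; more precisely, let $\lambda=\lambda_{m,j}$ be any eigenvalue of $L$ for which $(2m\pi)^2$ is a nearest point of the set $\{(2n\pi)^2:n\in\mathbb Z\}$. Let $\Psi=\Psi_{m,j}$ be any eigenfunction of $L$ for $\lambda$ with $\int_0^1|\Psi|^2dx=1$, and let $\Lambda_n=\lambda-(2n\pi)^2$. Define $$b_2=\sum_{m_1,m_2}\frac{q_{m_1}q_{m_2}q_{2m-m_1-m_2}}{\Lambda_{m-m_1}\Lambda_{m-m_1-m_2}},\qquad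 R_2=\sum_{m_1,m_2,m_3}\frac{q_{m_1}q_{m_2}q_{m_3}\,(q\Psi,e^{i2(m-m_1-m_2-m_3)\pi x})}{\Lambda_{m-m_1}\Lambda_{m-m_1-m_2}\Lambda_{m-m_1-m_2-m_3}},$$ summed over integers $m_i\ne0$ all of whose partial sums $m_1$, $m_1+m_2$ (and $m_1+m_2+m_3$ for $R_2$) differ from $0$ and $2m$, and $$b'_2=\sum_{m_1,m_2}\frac{q_{m_1}q_{m_2}q_{-2m-m_1-m_2}}{\Lambda_{m+m_1}\Lambda_{m+m_1+m_2}},\qquad R'_2=\sum_{m_1,m_2,m_3}\frac{q_{m_1}q_{m_2}q_{m_3}\,(q\Psi,e^{i2(m+m_1+m_2+m_3)\pi x})}{\Lambda_{m+m_1}\Lambda_{m+m_1+m_2}\Lambda_{m+m_1+m_2+m_3}},$$ summed over integers $m_i\ne0$ all of whose partial sums differ from $0$ and $-2m$. Then there are constants $C$ and $N$, depending only on $q$, such that for all $m\ge N$ and all such $\lambda$ and $\Psi$ the denominators do not vanish, the four series converge absolutely, and $$|b_2|,\ |b'_2|\le C\,\rho(m)\,m^{-2},\qquad |R_2|,\ |R'_2|\le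 C\,\rho(m)\,m^{-1}.$$ -/

import Mathlib

open MeasureTheory Set

noncomputable section

namespace Hill

/-- The Fourier coefficient `(f, e^{i 2 n π x}) = ∫₀¹ f(x) e^{-i 2 n π x} dx`. -/
def fourierCoef (f : ℝ → ℂ) (n : ℤ) : ℂ :=
  ∫ x in (0 : ℝ)..1, f x * Complex.exp (-(2 * Real.pi * Complex.I * n * x))

/-- `y` solves `y'' + (lam - q) y = 0` on `[0,1]` together with the periodic boundary conditions
`y(1) = y(0)`, `y'(1) = y'(0)`. As `q` is only summable, the derivative `y'` is absolutely
continuous and the equation holds almost everywhere. -/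
def IsPeriodicSolution (q : ℝ → ℂ) (lam : ℂ) (y : ℝ → ℂ) : Prop :=
  ∃ y' : ℝ → ℂ,
    (∀ x ∈ Icc (0 : ℝ) 1, HasDerivWithinAt y (y' x) (Icc 0 1) x) ∧
    AbsolutelyContinuousOnInterval y' 0 1 ∧
    (∀ᵐ x ∂(volume.restrict (Ioo (0 : ℝ) 1)), HasDerivAt y' ((q x - lam) * y x) x) ∧
    y 1 = y 0 ∧ y' 1 = y' 0

/-- `lam` is an eigenvalue of the periodic Sturm–Liouville operator `L` with potential `q`. -/
def IsEigenvalue (q : ℝ → ℂ) (lam : ℂ) : Prop :=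
  ∃ y : ℝ → ℂ, IsPeriodicSolution q lam y ∧ ∃ x ∈ Icc (0 : ℝ) 1, y x ≠ 0

/-- `y` is an eigenfunction of `L` for `lam`, normalized in `L₂[0,1]`. -/
def IsNormalizedEigenfunction (q : ℝ → ℂ) (lam : ℂ) (y : ℝ → ℂ) : Prop :=
  IsPeriodicSolution q lam y ∧ ∫ x in (0 : ℝ)..1, ‖y x‖ ^ 2 = 1

/-- `Λ_n = lam - (2 n π)²`. -/
def Lam (lam : ℂ) (n : ℤ) : ℂ := lam - ((2 * n * Real.pi) ^ 2 : ℝ)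

/-- `lam` is an eigenvalue of `L` for which `(2 m π)²` is a nearest point of the unperturbed
spectrum `{(2 n π)² : n ∈ ℤ}`. This sorts all the eigenvalues of `L` into groups; for large `m`
the eigenvalues `λ_{m,1}`, `λ_{m,2}` are the members of the group of index `m`. -/
def IsEigenvalueOfIndex (q : ℝ → ℂ) (m : ℕ) (lam : ℂ) : Prop :=
  IsEigenvalue q lam ∧ ∀ n : ℤ, ‖Lam lam m‖ ≤ ‖Lam lam n‖

/-- `ρ(m)`, the larger of `sup_{0 ≤ x ≤ 1} |∫₀ˣ q(t) e^{∓ i 2 (2 m) π t} dt|`. -/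
def rho (q : ℝ → ℂ) (m : ℕ) : ℝ :=
  max
    (⨆ x : Icc (0 : ℝ) 1,
      ‖∫ t in (0 : ℝ)..x, q t * Complex.exp (-(2 * (2 * m) * Real.pi * Complex.I * t))‖)
    (⨆ x : Icc (0 : ℝ) 1,
      ‖∫ t in (0 : ℝ)..x, q t * Complex.exp (2 * (2 * m) * Real.pi * Complex.I * t)‖)

/-- The pairs `(m₁, m₂)` with `m_i ≠ 0` and `m₁, m₁ + m₂ ∉ {0, c}`; used with `c = ± 2 m`. -/
def idx₂ (c : ℤ) : Set (ℤ × ℤ) :=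
  {p | p.1 ≠ 0 ∧ p.2 ≠ 0 ∧ p.1 ≠ c ∧ p.1 + p.2 ≠ 0 ∧ p.1 + p.2 ≠ c}

/-- The triples `(m₁, m₂, m₃)` with `m_i ≠ 0` and
`m₁, m₁ + m₂, m₁ + m₂ + m₃ ∉ {0, c}`; used with `c = ± 2 m`. -/
def idx₃ (c : ℤ) : Set (ℤ × ℤ × ℤ) :=
  {p | p.1 ≠ 0 ∧ p.2.1 ≠ 0 ∧ p.2.2 ≠ 0 ∧ p.1 ≠ c ∧
    p.1 + p.2.1 ≠ 0 ∧ p.1 + p.2.1 ≠ c ∧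
    p.1 + p.2.1 + p.2.2 ≠ 0 ∧ p.1 + p.2.1 + p.2.2 ≠ c}

/-- The general term of `b₂(lam)`. -/
def b₂Term (q : ℝ → ℂ) (m : ℕ) (lam : ℂ) (p : ℤ × ℤ) : ℂ :=
  fourierCoef q p.1 * fourierCoef q p.2 * fourierCoef q (2 * m - p.1 - p.2) /
    (Lam lam (m - p.1) * Lam lam (m - p.1 - p.2))

/-- The general term of `b'₂(lam)`. -/
def b₂Term' (q : ℝ → ℂ) (m : ℕ) (lam : ℂ) (p : ℤ × ℤ) : ℂ :=
  fourierCoef q p.1 * fourierCoef q p.2 * fourierCoef q (-2 * m - p.1 - p.2) /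
    (Lam lam (m + p.1) * Lam lam (m + p.1 + p.2))

/-- The general term of `R₂(m)`, for the eigenfunction `Ψ`. -/
def R₂Term (q : ℝ → ℂ) (m : ℕ) (lam : ℂ) (Ψ : ℝ → ℂ) (p : ℤ × ℤ × ℤ) : ℂ :=
  fourierCoef q p.1 * fourierCoef q p.2.1 * fourierCoef q p.2.2 *
      fourierCoef (fun x => q x * Ψ x) (m - p.1 - p.2.1 - p.2.2) /
    (Lam lam (m - p.1) * Lam lam (m - p.1 - p.2.1) * Lam lam (m - p.1 - p.2.1 - p.2.2))

/-- The general term of `R'₂(m)`, for the eigenfunction `Ψ`. -/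
def R₂Term' (q : ℝ → ℂ) (m : ℕ) (lam : ℂ) (Ψ : ℝ → ℂ) (p : ℤ × ℤ × ℤ) : ℂ :=
  fourierCoef q p.1 * fourierCoef q p.2.1 * fourierCoef q p.2.2 *
      fourierCoef (fun x => q x * Ψ x) (m + p.1 + p.2.1 + p.2.2) /
    (Lam lam (m + p.1) * Lam lam (m + p.1 + p.2.1) * Lam lam (m + p.1 + p.2.1 + p.2.2))

/-- `b₂(lam)`. -/
def b₂ (q : ℝ → ℂ) (m : ℕ) (lam : ℂ) : ℂ :=
  ∑' p : idx₂ (2 * m), b₂Term q m lam p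

/-- `b'₂(lam)`. -/
def b₂' (q : ℝ → ℂ) (m : ℕ) (lam : ℂ) : ℂ :=
  ∑' p : idx₂ (-2 * m), b₂Term' q m lam p

/-- `R₂(m)`. -/
def R₂ (q : ℝ → ℂ) (m : ℕ) (lam : ℂ) (Ψ : ℝ → ℂ) : ℂ :=
  ∑' p : idx₃ (2 * m), R₂Term q m lam Ψ p

/-- `R'₂(m)`. -/
def R₂' (q : ℝ → ℂ) (m : ℕ) (lam : ℂ) (Ψ : ℝ → ℂ) : ℂ :=
  ∑' p : idx₃ (-2 * m), R₂Term' q m lam Ψ p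

end Hill

end

namespace Hill

/-! Write A for the L¹ norm of q. Since (2mπ)² is a nearest unperturbed point, |Λ_{m-k}| ≥
2π²|k||2m-k|, so every inverse denominator is at most the weight `wt (2 * m) k`. The weights sum to
O(m^(-2/3)) and their squares to O(m⁻²) (`exists_tsum_wt_le`). For large m the Fourier series of an
eigenfunction is then controlled by its coefficients at ±m, which gives |Λ_m| ≤ 4A and, for
normalized Ψ, a sup bound (`IsPeriodicSolution.exists_sup_le`).

Unless all coefficients of q vanish, ρ(m) ≥ c/m (`exists_div_le_rho`), so an error O(m⁻²) is also
O(ρ(m)/m). This settles R₂ and R'₂: termwise bounds give a constant times the cube of the weight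
sum, which is O(m⁻²).

For b₂ absolute values are too crude. Let u have coefficients q_n/Λ_{m-n} for n ≠ 0, 2m, and zero
otherwise. Then b₂ is the coefficient of u²q at 2m (`b₂_eq_fourierCoef`). Replacing Λ_m by 0 in the
denominators changes u by O(m⁻²) and, by partial fractions, leaves κ(Q - e^{i4mπx}G) with κ =
i/(4πm), where Q and G are the mean-zero primitives of q and of q e^{-i4mπx} (with its mean
removed). As G = O(ρ(m)), u = κQ + O(ρ(m)/m) with κQ = O(1/m). The term κ²∫Q²q e^{-i4mπx} is
O(ρ(m)/m²) by integration by parts, and the remaining terms have that size trivially. Complex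
conjugation turns b'₂ into a b₂. -/

/-! ### Absolute continuity and integration by parts -/

/-- Increments of the primitive of `g` are dominated by those of the primitive of `‖g‖`, so the
real-valued case suffices. -/
theorem absolutelyContinuous_integral {g : ℝ → ℂ} (hg : IntervalIntegrable g volume 0 1) :
    AbsolutelyContinuousOnInterval (fun x => ∫ t in (0 : ℝ)..x, g t) 0 1 := by
  have hn := hg.norm.absolutelyContinuousOnInterval_intervalIntegral (c := 0) (by simp)
  rw [absolutelyContinuousOnInterval_iff] at hn ⊢
  intro ε hε
  obtain ⟨δ, hδ, h⟩ := hn ε hε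
  refine ⟨δ, hδ, fun E hE hlt => lt_of_le_of_lt (Finset.sum_le_sum fun i hi => ?_) (h E hE hlt)⟩
  have hmem := hE.1 i hi
  have hsub : ∀ x ∈ uIcc (0 : ℝ) 1, IntervalIntegrable g volume 0 x := fun x hx =>
    hg.mono_set (uIcc_subset_uIcc left_mem_uIcc hx)
  rw [dist_eq_norm, dist_eq_norm,
    intervalIntegral.integral_interval_sub_left (hsub _ hmem.1) (hsub _ hmem.2),
    intervalIntegral.integral_interval_sub_left (hsub _ hmem.1).norm (hsub _ hmem.2).norm]
  exact intervalIntegral.norm_integral_le_abs_integral_norm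

/-- Subtracting the primitive of `f'` leaves an absolutely continuous function with derivative zero
almost everywhere, hence a constant. -/
theorem integral_eq_sub_of_absolutelyContinuous {f f' : ℝ → ℂ}
    (hf : AbsolutelyContinuousOnInterval f 0 1)
    (hd : ∀ᵐ x, x ∈ Ioo (0 : ℝ) 1 → HasDerivAt f (f' x) x)
    (hi : IntervalIntegrable f' volume 0 1) :
    ∫ x in (0 : ℝ)..1, f' x = f 1 - f 0 := by
  have h0 : ∀ᵐ x : ℝ, x ≠ 0 := Measure.ae_ne volume 0
  have h1 : ∀ᵐ x : ℝ, x ≠ 1 := Measure.ae_ne volume 1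
  obtain ⟨C, hC⟩ := (hf.sub (absolutelyContinuous_integral hi)).const_of_ae_hasDerivAt_zero (by
    filter_upwards [hd, hi.ae_hasDerivAt_integral, h0, h1] with x hx hx' hx0 hx1 hx2
    have hx3 := hx2
    rw [uIcc_of_le zero_le_one] at hx3
    have := (hx ⟨lt_of_le_of_ne hx3.1 hx0.symm, lt_of_le_of_ne hx3.2 hx1⟩).sub
      (hx' hx2 0 left_mem_uIcc)
    rwa [sub_self] at this)
  have a := hC 0 left_mem_uIcc
  have b := hC 1 right_mem_uIcc
  simp only [Pi.sub_apply, intervalIntegral.integral_same, sub_zero] at a b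
  rw [a, ← b]; ring

theorem AbsolutelyContinuousOnInterval.mul_complex {f g : ℝ → ℂ}
    (hf : AbsolutelyContinuousOnInterval f 0 1) (hg : AbsolutelyContinuousOnInterval g 0 1) :
    AbsolutelyContinuousOnInterval (fun x => f x * g x) 0 1 :=
  hf.smul hg

theorem integral_by_parts {f f' g g' : ℝ → ℂ}
    (hf : AbsolutelyContinuousOnInterval f 0 1)
    (hfd : ∀ᵐ x, x ∈ Ioo (0 : ℝ) 1 → HasDerivAt f (f' x) x)
    (hfi : IntervalIntegrable f' volume 0 1)
    (hg : AbsolutelyContinuousOnInterval g 0 1)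
    (hgd : ∀ᵐ x, x ∈ Ioo (0 : ℝ) 1 → HasDerivAt g (g' x) x)
    (hgi : IntervalIntegrable g' volume 0 1) :
    ∫ x in (0 : ℝ)..1, f x * g' x = f 1 * g 1 - f 0 * g 0 - ∫ x in (0 : ℝ)..1, f' x * g x := by
  have i1 : IntervalIntegrable (fun x => f' x * g x) volume 0 1 := hfi.mul_continuousOn hg.continuousOn
  have i2 : IntervalIntegrable (fun x => f x * g' x) volume 0 1 :=
    hgi.continuousOn_mul hf.continuousOn
  have := integral_eq_sub_of_absolutelyContinuous (f' := fun x => f' x * g x + f x * g' x)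
    (AbsolutelyContinuousOnInterval.mul_complex hf hg) (by
      filter_upwards [hfd, hgd] with x h1 h2 h3
      exact (h1 h3).mul (h2 h3)) (i1.add i2)
  rw [intervalIntegral.integral_add i1 i2] at this
  rw [← this]; ring

theorem ae_hasDerivAt_primitive {g : ℝ → ℂ} (hg : IntervalIntegrable g volume 0 1) :
    ∀ᵐ x, x ∈ Ioo (0 : ℝ) 1 → HasDerivAt (fun x => ∫ t in (0 : ℝ)..x, g t) (g x) x := by
  filter_upwards [hg.ae_hasDerivAt_integral] with x hx h
  exact hx (by rw [uIcc_of_le zero_le_one]; exact Ioo_subset_Icc_self h) 0 left_mem_uIcc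

/-! ### Exponentials and Fourier coefficients on [0,1] -/

/-- The exponential `e^{i 2 n π x}`. -/
noncomputable def wave (n : ℤ) (x : ℝ) : ℂ := Complex.exp (2 * Real.pi * Complex.I * n * x)

theorem norm_wave (n : ℤ) (x : ℝ) : ‖wave n x‖ = 1 := by
  have : (2 * Real.pi * Complex.I * n * x : ℂ) = ((2 * Real.pi * n * x : ℝ) : ℂ) * Complex.I := by
    push_cast; ring
  rw [wave, this, Complex.norm_exp_ofReal_mul_I]

theorem wave_add (n k : ℤ) (x : ℝ) : wave (n + k) x = wave n x * wave k x := by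
  rw [wave, wave, wave, ← Complex.exp_add]; push_cast; ring_nf

@[simp] theorem wave_zero_left (x : ℝ) : wave 0 x = 1 := by simp [wave]

@[simp] theorem wave_zero_right (n : ℤ) : wave n 0 = 1 := by simp [wave]

@[simp] theorem wave_one_right (n : ℤ) : wave n 1 = 1 := by
  rw [wave, Complex.exp_eq_one_iff]; exact ⟨n, by push_cast; ring⟩

theorem conj_wave (n : ℤ) (x : ℝ) : (starRingEnd ℂ) (wave n x) = wave (-n) x := by
  rw [wave, wave, ← Complex.exp_conj]
  simp [Complex.conj_ofNat]

theorem hasDerivAt_wave (n : ℤ) (x : ℝ) :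
    HasDerivAt (wave n) (2 * Real.pi * Complex.I * n * wave n x) x := by
  have := ((Complex.ofRealCLM.hasDerivAt (x := x)).const_mul (2 * Real.pi * Complex.I * n)).cexp
  convert! this using 1
  simp only [wave, Complex.ofRealCLM_apply, Complex.ofReal_one, mul_one]
  ring

theorem contDiff_wave (n : ℤ) : ContDiff ℝ 1 (wave n) := by
  have : ContDiff ℝ 1 fun x : ℝ => (x : ℂ) := Complex.ofRealCLM.contDiff
  unfold wave; fun_prop

@[fun_prop] theorem continuous_wave (n : ℤ) : Continuous (wave n) := (contDiff_wave n).continuous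

theorem absolutelyContinuous_wave (n : ℤ) : AbsolutelyContinuousOnInterval (wave n) 0 1 :=
  (contDiff_wave n).contDiffOn.absolutelyContinuousOnInterval

theorem fourierCoef_eq (f : ℝ → ℂ) (n : ℤ) :
    fourierCoef f n = ∫ x in (0 : ℝ)..1, f x * wave (-n) x := by
  simp [fourierCoef, wave]

theorem IntervalIntegrable.mul_wave {f : ℝ → ℂ} (hf : IntervalIntegrable f volume 0 1) (n : ℤ) :
    IntervalIntegrable (fun x => f x * wave n x) volume 0 1 :=
  hf.mul_continuousOn (continuous_wave n).continuousOn

theorem norm_fourierCoef_le (f : ℝ → ℂ) (n : ℤ) :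
    ‖fourierCoef f n‖ ≤ ∫ x in (0 : ℝ)..1, ‖f x‖ := by
  rw [fourierCoef_eq]
  refine (intervalIntegral.norm_integral_le_integral_norm zero_le_one).trans_eq ?_
  simp [norm_wave]

theorem fourierCoef_sub {f g : ℝ → ℂ} (hf : IntervalIntegrable f volume 0 1)
    (hg : IntervalIntegrable g volume 0 1) (n : ℤ) :
    fourierCoef (fun x => f x - g x) n = fourierCoef f n - fourierCoef g n := by
  simp only [fourierCoef_eq, sub_mul]
  exact intervalIntegral.integral_sub (IntervalIntegrable.mul_wave hf _)
    (IntervalIntegrable.mul_wave hg _)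

theorem fourierCoef_const_mul (c : ℂ) (f : ℝ → ℂ) (n : ℤ) :
    fourierCoef (fun x => c * f x) n = c * fourierCoef f n := by
  simp only [fourierCoef_eq, mul_assoc, intervalIntegral.integral_const_mul]

theorem fourierCoef_wave_mul (k : ℤ) (f : ℝ → ℂ) (n : ℤ) :
    fourierCoef (fun x => wave k x * f x) n = fourierCoef f (n - k) := by
  simp only [fourierCoef_eq]
  congr 1; ext x
  rw [show -(n - k) = k + -n by ring, wave_add]; ring

theorem fourierCoef_conj (f : ℝ → ℂ) (n : ℤ) :
    fourierCoef (fun x => (starRingEnd ℂ) (f x)) n = (starRingEnd ℂ) (fourierCoef f (-n)) := by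
  rw [fourierCoef_eq, fourierCoef_eq, intervalIntegral.integral_of_le zero_le_one,
    intervalIntegral.integral_of_le zero_le_one, ← integral_conj]
  simp [conj_wave]

theorem fourierCoef_deriv {f f' : ℝ → ℂ} (hf : AbsolutelyContinuousOnInterval f 0 1)
    (hd : ∀ᵐ x, x ∈ Ioo (0 : ℝ) 1 → HasDerivAt f (f' x) x)
    (hi : IntervalIntegrable f' volume 0 1) (h01 : f 1 = f 0) (n : ℤ) :
    fourierCoef f' n = 2 * Real.pi * Complex.I * n * fourierCoef f n := by
  have hw : IntervalIntegrable (fun x => 2 * Real.pi * Complex.I * ((-n : ℤ) : ℂ) * wave (-n) x)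
      volume 0 1 := (by fun_prop : Continuous _).intervalIntegrable _ _
  have := integral_by_parts (absolutelyContinuous_wave (-n)) (.of_forall fun x _ => hasDerivAt_wave (-n) x)
    hw hf hd hi
  simp only [wave_one_right, wave_zero_right, h01, sub_self, zero_sub] at this
  rw [fourierCoef_eq, fourierCoef_eq, ← intervalIntegral.integral_const_mul]
  simp_rw [mul_comm (f' _)]
  rw [this, ← intervalIntegral.integral_neg]
  congr 1; ext x; push_cast; ring

theorem fourierCoef_const (c : ℂ) {n : ℤ} (hn : n ≠ 0) : fourierCoef (fun _ => c) n = 0 := by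
  have h := fourierCoef_deriv (f := fun _ => c) (f' := fun _ => 0)
    (contDiff_const (n := 1)).contDiffOn.absolutelyContinuousOnInterval
    (.of_forall fun x _ => hasDerivAt_const x c) (by simp) rfl n
  have h2 : fourierCoef (fun _ => (0 : ℂ)) n = 0 := by simp [fourierCoef]
  rw [h2] at h
  simpa [hn, Real.pi_ne_zero] using h.symm

theorem fourierCoef_const_zero (c : ℂ) : fourierCoef (fun _ => c) 0 = c := by
  simp [fourierCoef]

theorem hasSum_fourierCoef {f : ℝ → ℂ} (hf : ContinuousOn f (Icc 0 1)) (h01 : f 0 = f 1)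
    (hs : Summable (fourierCoef f)) {x : ℝ} (hx : x ∈ Icc (0 : ℝ) 1) :
    HasSum (fun n => fourierCoef f n * wave n x) (f x) := by
  have : Fact ((0 : ℝ) < 1) := ⟨one_pos⟩
  -- The lift to the circle reads `f` on [0,1) only; the endpoint 1 follows from periodicity.
  wlog hx1 : x < 1 generalizing x
  · obtain rfl : x = 1 := le_antisymm hx.2 (not_lt.mp hx1)
    have := this (x := 0) (by simp) one_pos
    simpa [h01] using this
  let F : C(AddCircle (1 : ℝ), ℂ) :=
    ⟨AddCircle.liftIco 1 0 f, AddCircle.liftIco_zero_continuous h01 hf⟩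
  have hc : fourierCoeff F = fourierCoef f := by
    ext n
    have : fourierCoeff (AddCircle.liftIco 1 0 f) n = fourierCoef f n := by
      rw [fourierCoeff_liftIco_eq, fourierCoeffOn_eq_integral, fourierCoef_eq]
      simp only [zero_add, sub_zero, div_one, one_smul]
      congr 1; ext x
      rw [fourier_coe_apply, smul_eq_mul, mul_comm, wave]
      simp
    exact this
  have := has_pointwise_sum_fourier_series_of_summable (f := F) (by rwa [hc]) (x : AddCircle (1 : ℝ))
  rw [hc] at this
  have hF : F (x : AddCircle (1 : ℝ)) = f x :=
    AddCircle.liftIco_coe_apply ⟨hx.1, by simpa using hx1⟩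
  rw [hF] at this
  convert! this using 2 with n
  rw [fourier_coe_apply, smul_eq_mul, wave]; simp

theorem continuous_tsum_wave {a : ℤ → ℂ} (ha : Summable fun n => ‖a n‖) :
    Continuous fun x => ∑' k, a k * wave k x :=
  continuous_tsum (fun k => by fun_prop) ha fun k x => by simp [norm_wave]

/-- Integrate the absolutely convergent series against `f` term by term, with dominating terms `‖a
k‖ * ‖f x‖`; summability of `f` is enough, no square integrability enters. -/
theorem hasSum_fourierCoef_mul {a : ℤ → ℂ} (ha : Summable fun n => ‖a n‖) {f : ℝ → ℂ}
    (hf : IntervalIntegrable f volume 0 1) (n : ℤ) :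
    HasSum (fun k => a k * fourierCoef f (n - k))
      (fourierCoef (fun x => (∑' k, a k * wave k x) * f x) n) := by
  have h := intervalIntegral.hasSum_integral_of_dominated_convergence
    (μ := volume) (a := 0) (b := 1) (F := fun k x => a k * wave k x * (f x * wave (-n) x))
    (f := fun x => (∑' k, a k * wave k x) * f x * wave (-n) x)
    (bound := fun k x => ‖a k‖ * ‖f x‖) ?_ ?_ ?_ ?_ ?_
  · rw [fourierCoef_eq]
    convert! h using 2 with k
    rw [← fourierCoef_wave_mul, fourierCoef_eq, ← intervalIntegral.integral_const_mul]
    congr 1; ext x; ring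
  · intro k
    have := (IntervalIntegrable.mul_wave hf (-n)).continuousOn_mul
      (g := fun x => a k * wave k x) (by fun_prop)
    exact this.def'.aestronglyMeasurable
  · intro k
    exact .of_forall fun x _ => by simp [norm_wave]
  · exact .of_forall fun x _ => ha.mul_right _
  · simp_rw [tsum_mul_right]
    exact hf.norm.const_mul _
  · refine .of_forall fun x _ => ?_
    have : Summable fun k => a k * wave k x := .of_norm (by simpa [norm_wave] using ha)
    simpa [mul_assoc] using this.hasSum.mul_right (f x * wave (-n) x)

/-! ### The weight 1/(|k||c-k|) and its sums -/

/-- `1 / (|k| |c - k|)`, which is `0` for `k = 0` and for `k = c`. -/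
noncomputable def wt (c k : ℤ) : ℝ := (|(k : ℝ)| * |(c - k : ℝ)|)⁻¹

theorem wt_nonneg (c k : ℤ) : 0 ≤ wt c k := by unfold wt; positivity

/-- Split t as t^(2/3) t^(1/3) and use t ≥ d in the first factor, t ≥ s in the second. The exponent
4/3 on s is summable, and the cube of d^(-2/3) is d⁻². -/
theorem inv_mul_le_rpow {s t d : ℝ} (hs : 0 < s) (hst : s ≤ t) (hd : 0 < d) (hdt : d ≤ t) :
    (s * t)⁻¹ ≤ d ^ (-(2 / 3) : ℝ) * s ^ (-(4 / 3) : ℝ) := by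
  have ht : 0 < t := hs.trans_le hst
  rw [Real.rpow_neg hd.le, Real.rpow_neg hs.le, ← mul_inv]
  apply inv_anti₀ (by positivity)
  have e1 : s ^ (4 / 3 : ℝ) = s * s ^ (1 / 3 : ℝ) := by
    rw [show (4 / 3 : ℝ) = 1 + 1 / 3 by norm_num, Real.rpow_add hs, Real.rpow_one]
  have e2 : t ^ (2 / 3 : ℝ) * t ^ (1 / 3 : ℝ) = t := by
    rw [← Real.rpow_add ht]; norm_num
  calc d ^ (2 / 3 : ℝ) * s ^ (4 / 3 : ℝ) = s * (d ^ (2 / 3 : ℝ) * s ^ (1 / 3 : ℝ)) := by rw [e1]; ring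
    _ ≤ s * (t ^ (2 / 3 : ℝ) * t ^ (1 / 3 : ℝ)) := by gcongr
    _ = s * t := by rw [e2]

theorem inv_mul_sq_le {s t d : ℝ} (hs : 0 < s) (hd : 0 < d) (hdt : d ≤ t) :
    ((s * t)⁻¹) ^ 2 ≤ (d ^ 2)⁻¹ * (s ^ 2)⁻¹ := by
  rw [inv_pow, ← mul_inv]
  apply inv_anti₀ (by positivity)
  rw [mul_pow, mul_comm]
  gcongr

/-- As |k| + |c-k| ≥ 2m, the larger of the two factors is at least m; the smaller one carries the
sum over k. -/
theorem wt_le {m : ℕ} (hm : 1 ≤ m) {c : ℤ} (hc : |c| = 2 * m) (k : ℤ) :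
    wt c k ≤ (m : ℝ) ^ (-(2 / 3) : ℝ) *
      (|(k : ℝ)| ^ (-(4 / 3) : ℝ) + |((c - k : ℤ) : ℝ)| ^ (-(4 / 3) : ℝ)) ∧
    wt c k ^ 2 ≤ ((m : ℝ) ^ 2)⁻¹ * (1 / (k : ℝ) ^ 2 + 1 / ((c - k : ℤ) : ℝ) ^ 2) := by
  have hm0 : (0 : ℝ) < m := by exact_mod_cast hm
  by_cases h : k = 0 ∨ k = c
  · have : wt c k = 0 := by rcases h with rfl | rfl <;> simp [wt]
    rw [this]
    refine ⟨by positivity, ?_⟩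
    rw [zero_pow two_ne_zero]; positivity
  · push Not at h
    have hk : 0 < |(k : ℝ)| := abs_pos.mpr (by exact_mod_cast h.1)
    have hck : 0 < |((c - k : ℤ) : ℝ)| := abs_pos.mpr (by
      exact_mod_cast sub_ne_zero.mpr (Ne.symm h.2))
    have hsum : (2 * m : ℝ) ≤ |(k : ℝ)| + |((c - k : ℤ) : ℝ)| := by
      have := abs_add_le k (c - k)
      rw [add_sub_cancel, hc] at this
      exact_mod_cast this
    have hw : wt c k = (|(k : ℝ)| * |((c - k : ℤ) : ℝ)|)⁻¹ := by simp [wt]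
    rw [hw, ← sq_abs (k : ℝ), ← sq_abs ((c - k : ℤ) : ℝ), one_div, one_div]
    rcases le_total |(k : ℝ)| |((c - k : ℤ) : ℝ)| with h1 | h1
    · refine ⟨(inv_mul_le_rpow hk h1 hm0 (by linarith)).trans ?_,
        (inv_mul_sq_le hk hm0 (by linarith)).trans ?_⟩
      · gcongr; exact le_add_of_nonneg_right (by positivity)
      · gcongr; exact le_add_of_nonneg_right (by positivity)
    · rw [mul_comm |(k : ℝ)|]
      refine ⟨(inv_mul_le_rpow hck h1 hm0 (by linarith)).trans ?_,
        (inv_mul_sq_le hck hm0 (by linarith)).trans ?_⟩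
      · gcongr; exact le_add_of_nonneg_left (by positivity)
      · gcongr; exact le_add_of_nonneg_left (by positivity)

theorem summable_add_comp_sub {f : ℤ → ℝ} (hf : Summable f) (a : ℝ) (c : ℤ) :
    HasSum (fun k => a * (f k + f (c - k))) (a * (2 * ∑' k, f k)) := by
  have h := (Equiv.subLeft c).hasSum_iff.mpr hf.hasSum
  rw [two_mul]
  exact (hf.hasSum.add h).mul_left a

theorem exists_tsum_wt_le : ∃ K : ℝ, 0 ≤ K ∧ ∀ m : ℕ, 1 ≤ m → ∀ c : ℤ, |c| = 2 * m →
    Summable (wt c) ∧ ∑' k, wt c k ≤ K * (m : ℝ) ^ (-(2 / 3) : ℝ) ∧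
    Summable (fun k => wt c k ^ 2) ∧ ∑' k, wt c k ^ 2 ≤ K / (m : ℝ) ^ 2 := by
  have s1 : Summable fun k : ℤ => |(k : ℝ)| ^ (-(4 / 3) : ℝ) :=
    Real.summable_abs_int_rpow (by norm_num)
  have s2 : Summable fun k : ℤ => 1 / (k : ℝ) ^ 2 := Real.summable_one_div_int_pow.mpr (by norm_num)
  have p1 : 0 ≤ ∑' k : ℤ, |(k : ℝ)| ^ (-(4 / 3) : ℝ) := tsum_nonneg fun k => by positivity
  have p2 : 0 ≤ ∑' k : ℤ, 1 / (k : ℝ) ^ 2 := tsum_nonneg fun k => by positivity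
  refine ⟨2 * (∑' k : ℤ, |(k : ℝ)| ^ (-(4 / 3) : ℝ)) + 2 * ∑' k : ℤ, 1 / (k : ℝ) ^ 2,
    by positivity, fun m hm c hc => ?_⟩
  have hm0 : (0 : ℝ) < m := by exact_mod_cast hm
  have h1 := summable_add_comp_sub s1 ((m : ℝ) ^ (-(2 / 3) : ℝ)) c
  have h2 := summable_add_comp_sub s2 (((m : ℝ) ^ 2)⁻¹) c
  have t1 : Summable (wt c) :=
    .of_nonneg_of_le (wt_nonneg c) (fun k => (wt_le hm hc k).1) h1.summable
  have t2 : Summable fun k => wt c k ^ 2 :=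
    .of_nonneg_of_le (fun k => sq_nonneg _) (fun k => (wt_le hm hc k).2) h2.summable
  refine ⟨t1, (hasSum_le (fun k => (wt_le hm hc k).1) t1.hasSum h1).trans ?_, t2,
    (hasSum_le (fun k => (wt_le hm hc k).2) t2.hasSum h2).trans ?_⟩
  · rw [mul_comm]; gcongr; linarith
  · rw [div_eq_inv_mul]; gcongr; linarith

theorem summable_subtype_of_le_mul₂ {w : ℤ → ℝ} (hw : ∀ k, 0 ≤ w k) (hs : Summable w)
    {S : Set (ℤ × ℤ)} {T : ℤ × ℤ → ℂ} {B : ℝ}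
    (hT : ∀ p ∈ S, ‖T p‖ ≤ B * (w p.1 * w (p.1 + p.2))) : Summable fun p : S => T p := by
  let e : ℤ × ℤ ≃ ℤ × ℤ :=
    { toFun := fun p => (p.1, p.1 + p.2), invFun := fun p => (p.1, p.2 - p.1)
      left_inv := fun p => by simp, right_inv := fun p => by simp }
  have h := (e.summable_iff.mpr (hs.mul_of_nonneg hs hw hw)).mul_left B
  exact .of_norm_bounded (h.subtype S) fun p => hT p.1 p.2

theorem summable_and_norm_tsum_le_of_le_mul₃ {w : ℤ → ℝ} (hw : ∀ k, 0 ≤ w k) (hs : Summable w)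
    {S : Set (ℤ × ℤ × ℤ)} {T : ℤ × ℤ × ℤ → ℂ} {B : ℝ} (hB : 0 ≤ B)
    (hT : ∀ p ∈ S, ‖T p‖ ≤ B * (w p.1 * (w (p.1 + p.2.1) * w (p.1 + p.2.1 + p.2.2)))) :
    (Summable fun p : S => T p) ∧ ‖∑' p : S, T p‖ ≤ B * (∑' k, w k) ^ 3 := by
  -- In the partial sums as new variables the bound is a product of three independent factors.
  let e : ℤ × ℤ × ℤ ≃ ℤ × ℤ × ℤ :=
    { toFun := fun p => (p.1, p.1 + p.2.1, p.1 + p.2.1 + p.2.2)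
      invFun := fun p => (p.1, p.2.1 - p.1, p.2.2 - p.2.1)
      left_inv := fun p => by simp, right_inv := fun p => by simp }
  have hw2 : ∀ p : ℤ × ℤ, 0 ≤ w p.1 * w p.2 := fun p => mul_nonneg (hw _) (hw _)
  have s2 := hs.mul_of_nonneg hs hw hw
  have s3 := hs.mul_of_nonneg s2 hw hw2
  have hsum : HasSum (fun p : ℤ × ℤ × ℤ => w p.1 * (w p.2.1 * w p.2.2)) ((∑' k, w k) ^ 3) := by
    have := s3.hasSum
    rw [← hs.tsum_mul_tsum s2 s3, ← hs.tsum_mul_tsum hs s2] at this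
    convert! this using 1; ring
  have h := (e.hasSum_iff.mpr hsum).mul_left B
  have hn : ∀ p : ℤ × ℤ × ℤ, 0 ≤ B * (w p.1 * (w (p.1 + p.2.1) * w (p.1 + p.2.1 + p.2.2))) := fun p =>
    mul_nonneg hB (mul_nonneg (hw _) (mul_nonneg (hw _) (hw _)))
  have hsub := h.summable.subtype S
  refine ⟨.of_norm_bounded hsub fun p => hT p p.2, ?_⟩
  refine (tsum_of_norm_bounded hsub.hasSum fun p => hT p.1 p.2).trans ?_
  rw [← h.tsum_eq]
  exact h.summable.tsum_subtype_le _ S hn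

/-! ### Lower bounds for the denominators -/

theorem Lam_sub_Lam (lam : ℂ) (n k : ℤ) :
    Lam lam n - Lam lam k = ((4 * Real.pi ^ 2 * ((k - n) * (k + n)) : ℝ) : ℂ) := by
  simp only [Lam]; push_cast; ring

theorem Lam_neg (lam : ℂ) (n : ℤ) : Lam lam (-n) = Lam lam n := by
  simp [Lam]

/-- The distance 4π²|m-n||m+n| between Λ_n and Λ_m is at most |Λ_n| + |Λ_m| ≤ 2|Λ_n|. -/
theorem le_norm_Lam {m : ℕ} {lam : ℂ} (h : ∀ n : ℤ, ‖Lam lam m‖ ≤ ‖Lam lam n‖) (n : ℤ) :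
    2 * Real.pi ^ 2 * (|(m - n : ℝ)| * |(m + n : ℝ)|) ≤ ‖Lam lam n‖ := by
  have h1 := norm_sub_le (Lam lam n) (Lam lam m)
  rw [Lam_sub_Lam, Complex.norm_real, Real.norm_eq_abs, abs_mul (4 * Real.pi ^ 2),
    abs_of_nonneg (by positivity : 0 ≤ 4 * Real.pi ^ 2), abs_mul] at h1
  push_cast at h1
  linarith [h n]

theorem two_pi_sq_ge_one : 1 ≤ 2 * Real.pi ^ 2 := by nlinarith [Real.pi_gt_three]

theorem inv_norm_Lam_le {m : ℕ} {lam : ℂ} (h : ∀ n : ℤ, ‖Lam lam m‖ ≤ ‖Lam lam n‖) {k : ℤ}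
    (h0 : k ≠ 0) (h1 : k ≠ 2 * m) : ‖Lam lam (m - k)‖⁻¹ ≤ wt (2 * m) k := by
  have hk : 0 < |(k : ℝ)| := abs_pos.mpr (by exact_mod_cast h0)
  have hck : 0 < |(2 * m - k : ℝ)| := abs_pos.mpr (by exact_mod_cast sub_ne_zero.mpr (Ne.symm h1))
  have := le_norm_Lam h (m - k)
  push_cast at this
  rw [show (m - (m - k) : ℝ) = k by ring, show (m + (m - k) : ℝ) = 2 * m - k by ring] at this
  unfold wt
  push_cast
  apply inv_anti₀ (by positivity)
  refine le_trans ?_ this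
  exact le_mul_of_one_le_left (by positivity) two_pi_sq_ge_one

theorem inv_norm_Lam_le' {m : ℕ} {lam : ℂ} (h : ∀ n : ℤ, ‖Lam lam m‖ ≤ ‖Lam lam n‖) {k : ℤ}
    (h0 : k ≠ 0) (h1 : k ≠ -2 * m) : ‖Lam lam (m + k)‖⁻¹ ≤ wt (-2 * m) k := by
  have := inv_norm_Lam_le h (k := -k) (by simpa using h0) (by intro h; apply h1; linarith)
  rw [sub_neg_eq_add] at this
  refine this.trans_eq ?_
  unfold wt
  push_cast
  rw [abs_neg, ← abs_neg (-2 * (m : ℝ) - k)]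
  ring_nf

theorem Lam_ne_zero {m : ℕ} {lam : ℂ} (h : ∀ n : ℤ, ‖Lam lam m‖ ≤ ‖Lam lam n‖) {n : ℤ}
    (h1 : n ≠ m) (h2 : n ≠ -m) : Lam lam n ≠ 0 := by
  have a : 0 < |(m - n : ℝ)| := abs_pos.mpr (by exact_mod_cast sub_ne_zero.mpr (Ne.symm h1))
  have b : 0 < |(m + n : ℝ)| := abs_pos.mpr (by
    exact_mod_cast fun h => h2 (eq_neg_of_add_eq_zero_right h))
  rw [← norm_pos_iff]
  exact lt_of_lt_of_le (by positivity) (le_norm_Lam h n)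

/-! ### Bounds for eigenvalues and eigenfunctions -/

theorem absolutelyContinuous_of_hasDerivWithinAt {y y' : ℝ → ℂ}
    (hy : ∀ x ∈ Icc (0 : ℝ) 1, HasDerivWithinAt y (y' x) (Icc 0 1) x)
    (hc : ContinuousOn y' (Icc 0 1)) : AbsolutelyContinuousOnInterval y 0 1 := by
  obtain ⟨C, hC⟩ := isCompact_Icc.exists_bound_of_continuousOn hc
  have := (convex_Icc (0 : ℝ) 1).lipschitzOnWith_of_nnnorm_hasDerivWithin_le (C := C.toNNReal) hy
    fun x hx => by
      rw [← NNReal.coe_le_coe, coe_nnnorm]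
      exact (hC x hx).trans (Real.le_coe_toNNReal C)
  exact LipschitzOnWith.absolutelyContinuousOnInterval (K := C.toNNReal)
    (by rwa [uIcc_of_le zero_le_one])

theorem IsPeriodicSolution.continuousOn {q y : ℝ → ℂ} {lam : ℂ} (h : IsPeriodicSolution q lam y) :
    ContinuousOn y (Icc 0 1) := by
  obtain ⟨y', h1, -⟩ := h
  exact fun x hx => (h1 x hx).continuousWithinAt

/-- Take the Fourier coefficient of the equation; two integrations by parts produce no boundary
terms because of the periodic conditions. -/
theorem IsPeriodicSolution.Lam_mul_fourierCoef {q y : ℝ → ℂ} {lam : ℂ}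
    (hq : IntervalIntegrable q volume 0 1) (h : IsPeriodicSolution q lam y) (n : ℤ) :
    Lam lam n * fourierCoef y n = fourierCoef (fun x => q x * y x) n := by
  have hyc := h.continuousOn
  have hyc' : ContinuousOn y (uIcc 0 1) := by rwa [uIcc_of_le zero_le_one]
  obtain ⟨y', h1, h2, h3, h4, h5⟩ := h
  have hc' : ContinuousOn y' (Icc 0 1) := by
    simpa [uIcc_of_le zero_le_one] using h2.continuousOn
  rw [ae_restrict_iff' measurableSet_Ioo] at h3
  have i1 : IntervalIntegrable (fun x => q x * y x) volume 0 1 := hq.mul_continuousOn hyc'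
  have i2 : IntervalIntegrable (fun x => lam * y x) volume 0 1 :=
    hyc'.intervalIntegrable.const_mul lam
  have hsub : (fun x => (q x - lam) * y x) = fun x => q x * y x - lam * y x := by
    ext x; ring
  have e1 := fourierCoef_deriv h2 h3 (by rw [hsub]; exact i1.sub i2) h5 n
  have e2 := fourierCoef_deriv (absolutelyContinuous_of_hasDerivWithinAt h1 hc')
    (.of_forall fun x hx => (h1 x (Ioo_subset_Icc_self hx)).hasDerivAt (Icc_mem_nhds hx.1 hx.2))
    h2.continuousOn.intervalIntegrable h4 n
  rw [hsub, fourierCoef_sub i1 i2, fourierCoef_const_mul, e2] at e1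
  rw [eq_add_of_sub_eq e1, Lam]
  push_cast
  linear_combination (-(2 * Real.pi * n) ^ 2 * fourierCoef y n) * Complex.I_sq

theorem norm_fourierCoef_mul_le {q y : ℝ → ℂ} (hq : IntervalIntegrable q volume 0 1)
    (hy : ContinuousOn y (Icc 0 1)) {M : ℝ} (hM : ∀ x ∈ Icc (0 : ℝ) 1, ‖y x‖ ≤ M) (n : ℤ) :
    ‖fourierCoef (fun x => q x * y x) n‖ ≤ (∫ x in (0 : ℝ)..1, ‖q x‖) * M := by
  refine (norm_fourierCoef_le _ _).trans ?_
  rw [← intervalIntegral.integral_mul_const]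
  refine intervalIntegral.integral_mono_on zero_le_one ?_ (hq.norm.mul_const M) fun x hx => ?_
  · exact (hq.mul_continuousOn (by rwa [uIcc_of_le zero_le_one])).norm
  · rw [norm_mul]; gcongr; exact hM x hx

/-- Evaluate the Fourier series at a maximum point of |y|. Coefficients off ±m are at most A M times
a weight, so together they contribute at most M/2, which is absorbed on the left. -/
theorem IsPeriodicSolution.exists_sup_le {q y : ℝ → ℂ} {lam : ℂ} {m : ℕ}
    (hq : IntervalIntegrable q volume 0 1) (h : IsPeriodicSolution q lam y)
    (hn : ∀ n : ℤ, ‖Lam lam m‖ ≤ ‖Lam lam n‖) (hs : Summable (wt (2 * m)))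
    (hw : (∫ x in (0 : ℝ)..1, ‖q x‖) * ∑' k, wt (2 * m) k ≤ 1 / 2) :
    ∃ M : ℝ, (∀ x ∈ Icc (0 : ℝ) 1, ‖y x‖ ≤ M) ∧
      M ≤ 2 * (‖fourierCoef y m‖ + ‖fourierCoef y (-m)‖) := by
  obtain ⟨x₀, hx₀, hmax⟩ := isCompact_Icc.exists_isMaxOn (nonempty_Icc.mpr zero_le_one)
    h.continuousOn.norm
  set A := ∫ x in (0 : ℝ)..1, ‖q x‖
  have hA : 0 ≤ A := intervalIntegral.integral_nonneg zero_le_one fun x _ => norm_nonneg _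
  set M := ‖y x₀‖ with hM
  have hle : ∀ x ∈ Icc (0 : ℝ) 1, ‖y x‖ ≤ M := fun x hx => hmax hx
  refine ⟨M, hle, ?_⟩
  have hcoef : ∀ n : ℤ, n ≠ m → n ≠ -m → ‖fourierCoef y n‖ ≤ A * M * wt (2 * m) (m - n) := by
    intro n h1 h2
    have e := h.Lam_mul_fourierCoef hq n
    have hl := inv_norm_Lam_le hn (k := m - n) (sub_ne_zero.mpr h1.symm) (by
      intro h; apply h2; linarith)
    rw [sub_sub_cancel] at hl
    have h0 := Lam_ne_zero hn h1 h2
    rw [show fourierCoef y n = fourierCoef (fun x => q x * y x) n / Lam lam n from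
      (eq_div_iff h0).mpr (by rw [mul_comm, e]), norm_div, div_eq_mul_inv]
    exact mul_le_mul (norm_fourierCoef_mul_le hq h.continuousOn hle n) hl (by positivity)
      (by positivity)
  let b : ℤ → ℝ := fun n => A * M * wt (2 * m) (m - n) +
    ((if n = m then ‖fourierCoef y m‖ else 0) + (if n = -m then ‖fourierCoef y (-m)‖ else 0))
  have hb : HasSum b (A * M * (∑' k, wt (2 * m) k) +
      (‖fourierCoef y m‖ + ‖fourierCoef y (-m)‖)) :=
    (((Equiv.subLeft (m : ℤ)).hasSum_iff.mpr hs.hasSum).mul_left (A * M)).add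
      ((hasSum_ite_eq _ _).add (hasSum_ite_eq _ _))
  have hcb : ∀ n, ‖fourierCoef y n‖ ≤ b n := by
    intro n
    have hp := mul_nonneg (by positivity : 0 ≤ A * M) (wt_nonneg (2 * m) (m - n))
    have f1 : 0 ≤ if n = (m : ℤ) then ‖fourierCoef y m‖ else 0 := by positivity
    have f2 : 0 ≤ if n = -(m : ℤ) then ‖fourierCoef y (-m)‖ else 0 := by positivity
    by_cases h1 : n = m
    · simp only [b] at *
      rw [if_pos h1]
      rw [h1] at hp f2 ⊢
      linarith
    by_cases h2 : n = -m
    · simp only [b] at *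
      rw [if_pos h2]
      rw [h2] at hp f1 ⊢
      linarith
    · simp only [b] at *
      linarith [hcoef n h1 h2]
  have hy01 : y 0 = y 1 := by obtain ⟨_, -, -, -, h, -⟩ := h; exact h.symm
  have hsum := hasSum_fourierCoef h.continuousOn hy01 (.of_norm_bounded hb.summable hcb) hx₀
  have := tsum_of_norm_bounded hb (f := fun n => fourierCoef y n * wave n x₀) fun n => by
    rw [norm_mul, norm_wave, mul_one]; exact hcb n
  rw [hsum.tsum_eq] at this
  have h2 : A * M * (∑' k, wt (2 * m) k) ≤ 1 / 2 * M := by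
    rw [mul_right_comm]; gcongr
  linarith

/-- Both |Λ_m y_m| and |Λ_m y_{-m}| are at most A M, while M ≤ 2(|y_m| + |y_{-m}|); divide by M. -/
theorem IsEigenvalue.norm_Lam_le {q : ℝ → ℂ} {lam : ℂ} {m : ℕ}
    (hq : IntervalIntegrable q volume 0 1) (h : IsEigenvalue q lam)
    (hn : ∀ n : ℤ, ‖Lam lam m‖ ≤ ‖Lam lam n‖) (hs : Summable (wt (2 * m)))
    (hw : (∫ x in (0 : ℝ)..1, ‖q x‖) * ∑' k, wt (2 * m) k ≤ 1 / 2) :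
    ‖Lam lam m‖ ≤ 4 * ∫ x in (0 : ℝ)..1, ‖q x‖ := by
  obtain ⟨y, hy, x, hx, hx0⟩ := h
  obtain ⟨M, h1, h2⟩ := hy.exists_sup_le hq hn hs hw
  have hM : 0 < M := (norm_pos_iff.mpr hx0).trans_le (h1 x hx)
  have e1 := norm_fourierCoef_mul_le hq hy.continuousOn h1 m
  have e2 := norm_fourierCoef_mul_le hq hy.continuousOn h1 (-m)
  rw [← hy.Lam_mul_fourierCoef hq, norm_mul] at e1 e2
  rw [Lam_neg] at e2
  refine le_of_mul_le_mul_right ?_ hM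
  nlinarith [mul_le_mul_of_nonneg_left h2 (norm_nonneg (Lam lam m))]

theorem IsNormalizedEigenfunction.norm_fourierCoef_mul_le {q Ψ : ℝ → ℂ} {lam : ℂ} {m : ℕ}
    (hq : IntervalIntegrable q volume 0 1) (h : IsNormalizedEigenfunction q lam Ψ)
    (hn : ∀ n : ℤ, ‖Lam lam m‖ ≤ ‖Lam lam n‖) (hs : Summable (wt (2 * m)))
    (hw : (∫ x in (0 : ℝ)..1, ‖q x‖) * ∑' k, wt (2 * m) k ≤ 1 / 2) (n : ℤ) :
    ‖fourierCoef (fun x => q x * Ψ x) n‖ ≤ (∫ x in (0 : ℝ)..1, ‖q x‖) * 4 := by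
  obtain ⟨M, h1, h2⟩ := h.1.exists_sup_le hq hn hs hw
  have hc : ContinuousOn (fun x => ‖Ψ x‖) (uIcc 0 1) := by
    rw [uIcc_of_le zero_le_one]; exact h.1.continuousOn.norm
  -- This bounds both coefficients at ±m by 1, whence |Ψ| ≤ 4.
  have hone : ∫ x in (0 : ℝ)..1, ‖Ψ x‖ ≤ 1 := by
    calc ∫ x in (0 : ℝ)..1, ‖Ψ x‖ ≤ ∫ x in (0 : ℝ)..1, (1 / 2 + 1 / 2 * ‖Ψ x‖ ^ 2) := by
          refine intervalIntegral.integral_mono_on zero_le_one hc.intervalIntegrable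
            (ContinuousOn.intervalIntegrable (by fun_prop)) fun x _ => ?_
          nlinarith [sq_nonneg (‖Ψ x‖ - 1)]
      _ = 1 := by
          rw [intervalIntegral.integral_add (by simp)
            (ContinuousOn.intervalIntegrable (by fun_prop)), intervalIntegral.integral_const_mul, h.2]
          norm_num
  refine Hill.norm_fourierCoef_mul_le hq h.1.continuousOn (fun x hx => (h1 x hx).trans ?_) n
  linarith [norm_fourierCoef_le Ψ m, norm_fourierCoef_le Ψ (-m)]

/-! ### The quantity ρ(m) -/

theorem wave_neg_two_mul (m : ℕ) (t : ℝ) :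
    wave (-(2 * m)) t = Complex.exp (-(2 * (2 * m) * Real.pi * Complex.I * t)) := by
  rw [wave]; push_cast; ring_nf

theorem wave_two_mul (m : ℕ) (t : ℝ) :
    wave (2 * m) t = Complex.exp (2 * (2 * m) * Real.pi * Complex.I * t) := by
  rw [wave]; push_cast; ring_nf

theorem norm_integral_wave_mul_le {q : ℝ → ℂ} (hq : IntervalIntegrable q volume 0 1) (n : ℤ)
    {x : ℝ} (hx : x ∈ Icc (0 : ℝ) 1) :
    ‖∫ t in (0 : ℝ)..x, wave n t * q t‖ ≤ ∫ t in (0 : ℝ)..1, ‖q t‖ := by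
  refine (intervalIntegral.norm_integral_le_integral_norm hx.1).trans ?_
  simp only [norm_mul, norm_wave, one_mul]
  exact intervalIntegral.integral_mono_interval le_rfl hx.1 hx.2
    (.of_forall fun t => norm_nonneg _) hq.norm

theorem rho_eq (q : ℝ → ℂ) (m : ℕ) :
    rho q m = max (⨆ x : Icc (0 : ℝ) 1, ‖∫ t in (0 : ℝ)..x, wave (-(2 * m)) t * q t‖)
      (⨆ x : Icc (0 : ℝ) 1, ‖∫ t in (0 : ℝ)..x, wave (2 * m) t * q t‖) := by
  simp only [wave_neg_two_mul, wave_two_mul, rho, mul_comm (Complex.exp _)]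

theorem rho_nonneg (q : ℝ → ℂ) (m : ℕ) : 0 ≤ rho q m :=
  le_max_of_le_left (Real.iSup_nonneg fun _ => norm_nonneg _)

theorem rho_le {q : ℝ → ℂ} (hq : IntervalIntegrable q volume 0 1) (m : ℕ) :
    rho q m ≤ ∫ t in (0 : ℝ)..1, ‖q t‖ := by
  rw [rho_eq]
  have : Nonempty (Icc (0 : ℝ) 1) := ⟨0, by simp⟩
  exact max_le (ciSup_le fun x => norm_integral_wave_mul_le hq _ x.2)
    (ciSup_le fun x => norm_integral_wave_mul_le hq _ x.2)

theorem norm_integral_le_rho {q : ℝ → ℂ} (hq : IntervalIntegrable q volume 0 1) (m : ℕ)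
    {x : ℝ} (hx : x ∈ Icc (0 : ℝ) 1) :
    ‖∫ t in (0 : ℝ)..x, wave (-(2 * m)) t * q t‖ ≤ rho q m := by
  rw [rho_eq]
  refine le_max_of_le_left (le_ciSup (f := fun x : Icc (0 : ℝ) 1 =>
    ‖∫ t in (0 : ℝ)..x, wave (-(2 * m)) t * q t‖) ?_ ⟨x, hx⟩)
  refine ⟨∫ t in (0 : ℝ)..1, ‖q t‖, ?_⟩
  rintro _ ⟨y, rfl⟩
  exact norm_integral_wave_mul_le hq _ y.2

/-- Conjugating `q` interchanges the two suprema. -/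
theorem rho_conj (q : ℝ → ℂ) (m : ℕ) : rho (fun x => (starRingEnd ℂ) (q x)) m = rho q m := by
  have key : ∀ (n : ℤ) (x : Icc (0 : ℝ) 1),
      ‖∫ t in (0 : ℝ)..x, wave n t * (starRingEnd ℂ) (q t)‖ =
        ‖∫ t in (0 : ℝ)..x, wave (-n) t * q t‖ := by
    intro n x
    rw [intervalIntegral.integral_of_le x.2.1, intervalIntegral.integral_of_le x.2.1,
      ← RCLike.norm_conj, ← integral_conj]
    simp [conj_wave]
  rw [rho_eq, rho_eq, max_comm]
  simp only [key, neg_neg]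

/-- Integrate by parts onto the primitive of `g`: an oscillating `g` is felt only through the sup of
its primitive. -/
theorem norm_integral_mul_le_of_norm_primitive_le {f f' g : ℝ → ℂ} {r : ℝ}
    (hf : AbsolutelyContinuousOnInterval f 0 1)
    (hfd : ∀ᵐ x, x ∈ Ioo (0 : ℝ) 1 → HasDerivAt f (f' x) x)
    (hfi : IntervalIntegrable f' volume 0 1) (hg : IntervalIntegrable g volume 0 1)
    (hr : ∀ x ∈ Icc (0 : ℝ) 1, ‖∫ t in (0 : ℝ)..x, g t‖ ≤ r) :
    ‖∫ x in (0 : ℝ)..1, f x * g x‖ ≤ (‖f 1‖ + ∫ x in (0 : ℝ)..1, ‖f' x‖) * r := by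
  have hG := absolutelyContinuous_integral hg
  rw [integral_by_parts hf hfd hfi hG (ae_hasDerivAt_primitive hg) hg,
    intervalIntegral.integral_same, mul_zero, sub_zero, add_mul]
  refine (norm_sub_le _ _).trans (add_le_add ?_ ?_)
  · rw [norm_mul]; gcongr; exact hr 1 (by simp)
  · refine (intervalIntegral.norm_integral_le_integral_norm zero_le_one).trans ?_
    rw [← intervalIntegral.integral_mul_const]
    refine intervalIntegral.integral_mono_on zero_le_one
      (hfi.mul_continuousOn hG.continuousOn).norm (hfi.norm.mul_const r) fun x hx => ?_
    rw [norm_mul]; gcongr; exact hr x hx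

theorem IntervalIntegrable.wave_mul {f : ℝ → ℂ} (hf : IntervalIntegrable f volume 0 1) (n : ℤ) :
    IntervalIntegrable (fun x => wave n x * f x) volume 0 1 :=
  hf.continuousOn_mul (continuous_wave n).continuousOn

/-- The fixed coefficient q_n is the integral of q e^{-i4mπx} against e^{i2(2m-n)πx}, whose
derivative is O(m); hence |q_n| ≤ D m ρ(m). -/
theorem exists_div_le_rho {q : ℝ → ℂ} (hq : IntervalIntegrable q volume 0 1) {n : ℤ}
    (hn : fourierCoef q n ≠ 0) : ∃ c : ℝ, 0 < c ∧ ∀ m : ℕ, 1 ≤ m → c / m ≤ rho q m := by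
  set D : ℝ := 1 + 2 * Real.pi * (2 + |(n : ℝ)|)
  have hD : 0 < D := by positivity
  refine ⟨‖fourierCoef q n‖ / D, div_pos (norm_pos_iff.mpr hn) hD, fun m hm => ?_⟩
  have hm1 : (1 : ℝ) ≤ m := by exact_mod_cast hm
  have h := norm_integral_mul_le_of_norm_primitive_le (absolutelyContinuous_wave (2 * m - n))
    (.of_forall fun x _ => hasDerivAt_wave _ x)
    ((by fun_prop : Continuous _).intervalIntegrable _ _)
    (IntervalIntegrable.wave_mul hq (-(2 * m))) (fun x hx => norm_integral_le_rho hq m hx)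
  have e : ∫ x in (0 : ℝ)..1, wave (2 * m - n) x * (wave (-(2 * m)) x * q x) = fourierCoef q n := by
    rw [fourierCoef_eq]
    congr 1; ext x
    rw [← mul_assoc, ← wave_add, mul_comm]
    congr 2; ring
  rw [e] at h
  have e2 : ∫ x in (0 : ℝ)..1, ‖2 * Real.pi * Complex.I * ((2 * m - n : ℤ) : ℂ) * wave (2 * m - n) x‖
      = 2 * Real.pi * |(2 * m - n : ℝ)| := by
    simp only [norm_mul, norm_wave, Complex.norm_I, Complex.norm_real, Complex.norm_intCast,
      Complex.norm_ofNat, mul_one, intervalIntegral.integral_const, sub_zero, one_smul]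
    rw [Real.norm_of_nonneg Real.pi_pos.le]; push_cast; rfl
  rw [e2, wave_one_right, norm_one] at h
  have h3 : |(2 * m - n : ℝ)| ≤ (2 + |(n : ℝ)|) * m := by
    refine (abs_sub _ _).trans ?_
    rw [abs_of_nonneg (by positivity)]
    nlinarith [abs_nonneg (n : ℝ)]
  have h4 : 1 + 2 * Real.pi * |(2 * m - n : ℝ)| ≤ D * m := by
    have := mul_le_mul_of_nonneg_left h3 (by positivity : 0 ≤ 2 * Real.pi)
    simp only [D]; nlinarith
  rw [div_div, div_le_iff₀ (by positivity)]
  calc _ ≤ _ := h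
    _ ≤ D * m * rho q m := mul_le_mul_of_nonneg_right h4 (rho_nonneg q m)
    _ = _ := mul_comm _ _

/-! ### Mean-zero primitives -/

/-- The primitive of `g - g₀` with mean value `0`. -/
noncomputable def prim (g : ℝ → ℂ) (x : ℝ) : ℂ :=
  (∫ t in (0 : ℝ)..x, (g t - fourierCoef g 0)) -
    fourierCoef (fun x => ∫ t in (0 : ℝ)..x, (g t - fourierCoef g 0)) 0

section prim

variable {g : ℝ → ℂ}

theorem absolutelyContinuous_prim (hg : IntervalIntegrable g volume 0 1) :
    AbsolutelyContinuousOnInterval (prim g) 0 1 :=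
  (absolutelyContinuous_integral (hg.sub intervalIntegrable_const)).sub
    (contDiff_const (n := 1)).contDiffOn.absolutelyContinuousOnInterval

theorem continuousOn_prim (hg : IntervalIntegrable g volume 0 1) :
    ContinuousOn (prim g) (Icc 0 1) := by
  simpa [uIcc_of_le zero_le_one] using (absolutelyContinuous_prim hg).continuousOn

theorem ae_hasDerivAt_prim (hg : IntervalIntegrable g volume 0 1) :
    ∀ᵐ x, x ∈ Ioo (0 : ℝ) 1 → HasDerivAt (prim g) (g x - fourierCoef g 0) x := by
  filter_upwards [ae_hasDerivAt_primitive (hg.sub intervalIntegrable_const)] with x hx h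
  exact (hx h).sub_const _

theorem fourierCoef_zero_eq (g : ℝ → ℂ) : fourierCoef g 0 = ∫ x in (0 : ℝ)..1, g x := by
  simp [fourierCoef]

theorem prim_zero_eq_prim_one (hg : IntervalIntegrable g volume 0 1) : prim g 0 = prim g 1 := by
  simp only [prim, intervalIntegral.integral_same]
  rw [intervalIntegral.integral_sub hg intervalIntegrable_const, ← fourierCoef_zero_eq]
  simp

theorem fourierCoef_prim (hg : IntervalIntegrable g volume 0 1) (n : ℤ) :
    fourierCoef (prim g) n = fourierCoef g n / (2 * Real.pi * Complex.I * n) := by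
  have hc := (absolutelyContinuous_integral
    (hg.sub (intervalIntegrable_const (c := fourierCoef g 0)))).continuousOn.intervalIntegrable
      (μ := volume)
  rcases eq_or_ne n 0 with rfl | hn
  · have := fourierCoef_sub hc (intervalIntegrable_const
      (c := fourierCoef (fun x => ∫ t in (0 : ℝ)..x, (g t - fourierCoef g 0)) 0)) 0
    rw [fourierCoef_const_zero, sub_self] at this
    rw [Int.cast_zero, mul_zero, div_zero]
    exact this
  · have := fourierCoef_deriv (absolutelyContinuous_prim hg) (ae_hasDerivAt_prim hg)
      (hg.sub intervalIntegrable_const) (prim_zero_eq_prim_one hg).symm n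
    rw [fourierCoef_sub hg intervalIntegrable_const, fourierCoef_const _ hn, sub_zero] at this
    rw [this, mul_div_cancel_left₀]
    simp [hn, Real.pi_ne_zero]

theorem norm_prim_le (hg : IntervalIntegrable g volume 0 1) {r : ℝ}
    (hr : ∀ x ∈ Icc (0 : ℝ) 1, ‖∫ t in (0 : ℝ)..x, g t‖ ≤ r) {x : ℝ} (hx : x ∈ Icc (0 : ℝ) 1) :
    ‖prim g x‖ ≤ 4 * r := by
  have h0 : ‖fourierCoef g 0‖ ≤ r := by
    rw [fourierCoef_zero_eq]; exact hr 1 (by simp)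
  -- The primitive of `g` and the linear correction cost `r` each; subtracting the mean doubles the
  -- result to `4 * r`.
  have h1 : ∀ x ∈ Icc (0 : ℝ) 1, ‖∫ t in (0 : ℝ)..x, (g t - fourierCoef g 0)‖ ≤ 2 * r := by
    intro x hx
    rw [intervalIntegral.integral_sub (hg.mono_set (uIcc_subset_uIcc left_mem_uIcc
      (by rwa [uIcc_of_le zero_le_one]))) intervalIntegrable_const]
    refine (norm_sub_le _ _).trans ?_
    rw [intervalIntegral.integral_const, sub_zero, norm_smul, Real.norm_of_nonneg hx.1]
    nlinarith [hr x hx, hx.1, hx.2, norm_nonneg (fourierCoef g 0)]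
  have h2 : ‖fourierCoef (fun x => ∫ t in (0 : ℝ)..x, (g t - fourierCoef g 0)) 0‖ ≤ 2 * r := by
    rw [fourierCoef_zero_eq]
    refine (intervalIntegral.norm_integral_le_of_norm_le_const (C := 2 * r) fun x hx => ?_).trans
      (by simp)
    rw [uIoc_of_le zero_le_one] at hx
    exact h1 x (Ioc_subset_Icc_self hx)
  refine (norm_sub_le _ _).trans ?_
  linarith [h1 x hx]

end prim

/-! ### The estimate of b₂ -/

/-- The coefficients `q_n / Λ_{m-n}` for `n ≠ 0, 2m`, extended by `0`. -/
noncomputable def resCoef (q : ℝ → ℂ) (m : ℕ) (lam : ℂ) (n : ℤ) : ℂ :=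
  if n = 0 ∨ n = 2 * m then 0 else fourierCoef q n / Lam lam (m - n)

/-- The continuous function with Fourier coefficients `resCoef`. -/
noncomputable def resFun (q : ℝ → ℂ) (m : ℕ) (lam : ℂ) (x : ℝ) : ℂ :=
  ∑' n, resCoef q m lam n * wave n x

section

variable {q : ℝ → ℂ} {m : ℕ} {lam : ℂ}

theorem norm_resCoef_le (hn : ∀ n : ℤ, ‖Lam lam m‖ ≤ ‖Lam lam n‖) (n : ℤ) :
    ‖resCoef q m lam n‖ ≤ (∫ x in (0 : ℝ)..1, ‖q x‖) * wt (2 * m) n := by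
  have hA : 0 ≤ ∫ x in (0 : ℝ)..1, ‖q x‖ :=
    intervalIntegral.integral_nonneg zero_le_one fun x _ => norm_nonneg _
  unfold resCoef
  split_ifs with h
  · rw [norm_zero]; exact mul_nonneg hA (wt_nonneg _ _)
  · push Not at h
    rw [norm_div, div_eq_mul_inv]
    exact mul_le_mul (norm_fourierCoef_le q n) (inv_norm_Lam_le hn h.1 h.2) (by positivity) hA

theorem summable_norm_resCoef (hn : ∀ n : ℤ, ‖Lam lam m‖ ≤ ‖Lam lam n‖)
    (hs : Summable (wt (2 * m))) : Summable fun n => ‖resCoef q m lam n‖ :=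
  .of_nonneg_of_le (fun _ => norm_nonneg _) (norm_resCoef_le hn) (hs.mul_left _)

theorem continuous_resFun (hn : ∀ n : ℤ, ‖Lam lam m‖ ≤ ‖Lam lam n‖)
    (hs : Summable (wt (2 * m))) : Continuous (resFun q m lam) :=
  continuous_tsum_wave (summable_norm_resCoef hn hs)

/-- Expanding both factors `resFun` gives a double convolution, which matches b₂ after renaming one
index, since Λ_n is even in n. Zero values of `resCoef` encode the excluded partial sums. -/
theorem b₂_eq_fourierCoef (hq : IntervalIntegrable q volume 0 1) (hq0 : fourierCoef q 0 = 0)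
    (hn : ∀ n : ℤ, ‖Lam lam m‖ ≤ ‖Lam lam n‖) (hs : Summable (wt (2 * m))) :
    b₂ q m lam =
      fourierCoef (fun x => resFun q m lam x * (resFun q m lam x * q x)) (2 * m) := by
  set a := resCoef q m lam
  have ha : Summable fun n => ‖a n‖ := summable_norm_resCoef hn hs
  have hi : IntervalIntegrable (fun x => resFun q m lam x * q x) volume 0 1 :=
    hq.continuousOn_mul (continuous_resFun hn hs).continuousOn
  have h1 := hasSum_fourierCoef_mul ha hi (2 * m)
  have h2 := fun k => hasSum_fourierCoef_mul ha hq (2 * m - k)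
  let F : ℤ × ℤ → ℂ := fun p => a p.1 * (a p.2 * fourierCoef q (2 * m - p.1 - p.2))
  have hF : Summable F := by
    refine .of_norm_bounded ((ha.mul_of_nonneg ha (fun _ => norm_nonneg _)
      fun _ => norm_nonneg _).mul_right (∫ x in (0 : ℝ)..1, ‖q x‖)) fun p => ?_
    simp only [F, norm_mul]
    rw [← mul_assoc]
    gcongr
    exact norm_fourierCoef_le q _
  have h3 : ∑' p, F p =
      fourierCoef (fun x => resFun q m lam x * (resFun q m lam x * q x)) (2 * m) := by
    rw [hF.tsum_prod]
    refine Eq.trans ?_ h1.tsum_eq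
    congr 1; ext k
    simp only [F]
    rw [tsum_mul_left, (h2 k).tsum_eq]; rfl
  -- This involution exchanges the second index with the index of the third coefficient; the
  -- exclusion m₂ ≠ 0 is then automatic from q₀ = 0.
  let e : ℤ × ℤ ≃ ℤ × ℤ :=
    { toFun := fun p => (p.1, 2 * m - p.1 - p.2), invFun := fun p => (p.1, 2 * m - p.1 - p.2)
      left_inv := fun p => by simp, right_inv := fun p => by simp }
  rw [← h3, ← e.tsum_eq F, b₂, tsum_subtype (idx₂ (2 * m)) (b₂Term q m lam)]
  congr 1; ext ⟨p₁, p₂⟩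
  simp only [F, e, Equiv.coe_fn_mk, sub_sub_cancel, indicator_apply, idx₂, mem_ofPred_eq, a, resCoef,
    b₂Term]
  have hL : Lam lam (m - p₁ - p₂) = Lam lam (m - (2 * m - p₁ - p₂)) := by
    rw [← Lam_neg]; congr 1; ring
  by_cases h1 : p₁ = 0
  · simp [h1]
  by_cases h2 : p₁ = 2 * m
  · simp [h2]
  by_cases h3 : p₂ = 0
  · simp [h3, hq0]
  by_cases h4 : p₁ + p₂ = 0
  · simp [h4, sub_sub]
  by_cases h5 : p₁ + p₂ = 2 * m
  · simp [h5, sub_sub]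
  have h6 : ¬ 2 * m - p₁ - p₂ = 0 := by intro h; apply h5; linarith
  have h7 : ¬ 2 * m - p₁ - p₂ = 2 * m := by intro h; apply h4; linarith
  simp only [h1, h2, h3, h4, h5, h6, h7, hL, ne_eq, not_false_eq_true, and_self, if_true, or_self,
    if_false]
  simp only [div_eq_mul_inv, mul_inv]
  ring

/-- The leading part of `resFun`, in closed form. -/
noncomputable def resMain (q : ℝ → ℂ) (m : ℕ) (x : ℝ) : ℂ :=
  Complex.I / (4 * Real.pi * m) *
    (prim q x - wave (2 * m) x * prim (fun t => wave (-(2 * m)) t * q t) x)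

theorem continuousOn_resMain (hq : IntervalIntegrable q volume 0 1) :
    ContinuousOn (resMain q m) (Icc 0 1) :=
  continuousOn_const.mul ((continuousOn_prim hq).sub
    ((continuous_wave _).continuousOn.mul
      (continuousOn_prim (IntervalIntegrable.wave_mul hq _))))

/-- For n ≠ 0, 2m this is q_n/(4π²n(2m-n)), that is, q_n/Λ_{m-n} with Λ_m replaced by 0; the two
primitives supply the two partial fractions. -/
theorem fourierCoef_resMain (hq : IntervalIntegrable q volume 0 1) (n : ℤ) :
    fourierCoef (resMain q m) n =
      fourierCoef q n / (8 * Real.pi ^ 2 * m) * (1 / n - 1 / ((n - 2 * m : ℤ) : ℂ)) := by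
  have hg := IntervalIntegrable.wave_mul hq (-(2 * m))
  have i1 := (absolutelyContinuous_prim hq).continuousOn.intervalIntegrable (μ := volume)
  have i2 := (absolutelyContinuous_prim hg).continuousOn.intervalIntegrable (μ := volume)
  unfold resMain
  rw [fourierCoef_const_mul, fourierCoef_sub i1 (IntervalIntegrable.wave_mul i2 (2 * m)),
    fourierCoef_wave_mul, fourierCoef_prim hq, fourierCoef_prim hg, fourierCoef_wave_mul,
    show n - 2 * m - -(2 * m) = n by ring]
  have hpi : (Real.pi : ℂ) ≠ 0 := by exact_mod_cast Real.pi_ne_zero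
  simp only [div_eq_mul_inv, mul_inv, one_mul]
  rw [show (8 : ℂ)⁻¹ = 4⁻¹ * 2⁻¹ by norm_num]
  have hI : Complex.I * Complex.I⁻¹ = 1 := mul_inv_cancel₀ Complex.I_ne_zero
  linear_combination (4⁻¹ * (Real.pi : ℂ)⁻¹ * (m : ℂ)⁻¹ * fourierCoef q n * 2⁻¹ * (Real.pi : ℂ)⁻¹ *
    ((n : ℂ)⁻¹ - ((n - 2 * m : ℤ) : ℂ)⁻¹)) * hI

theorem norm_resCoef_sub_le (hm : 1 ≤ m) (hq : IntervalIntegrable q volume 0 1)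
    (hq0 : fourierCoef q 0 = 0) (hn : ∀ n : ℤ, ‖Lam lam m‖ ≤ ‖Lam lam n‖) {L : ℝ}
    (hL : ‖Lam lam m‖ ≤ L) (n : ℤ) :
    ‖resCoef q m lam n - fourierCoef (resMain q m) n‖ ≤
      (∫ x in (0 : ℝ)..1, ‖q x‖) *
        (L * wt (2 * m) n ^ 2 + if n = 2 * m then 1 / (m : ℝ) ^ 2 else 0) := by
  set A := ∫ x in (0 : ℝ)..1, ‖q x‖
  have hA : 0 ≤ A := intervalIntegral.integral_nonneg zero_le_one fun x _ => norm_nonneg _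
  have hL0 : 0 ≤ L := (norm_nonneg _).trans hL
  have hm0 : (m : ℝ) ≠ 0 := by positivity
  have hmc : (m : ℂ) ≠ 0 := by exact_mod_cast hm0
  have hpi : (Real.pi : ℂ) ≠ 0 := by exact_mod_cast Real.pi_ne_zero
  have hqn := norm_fourierCoef_le q n
  rw [fourierCoef_resMain hq]
  by_cases h0 : n = 0
  · rw [h0, hq0]
    simp only [resCoef, true_or, if_true, zero_div, zero_mul, sub_zero, norm_zero]
    have := wt_nonneg (2 * m) 0
    positivity
  by_cases h1 : n = 2 * m
  -- At n = 2m division by zero kills the second fraction, but the first leaves q_{2m}/(16π²m²), the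
  -- source of the extra 1/m².
  · have e : resCoef q m lam n - fourierCoef q n / (8 * Real.pi ^ 2 * m) *
        (1 / n - 1 / ((n - 2 * m : ℤ) : ℂ)) =
        -(fourierCoef q n * ((16 * Real.pi ^ 2 * m ^ 2 : ℝ) : ℂ)⁻¹) := by
      rw [resCoef, if_pos (Or.inr h1)]
      subst h1
      push_cast
      rw [sub_self]
      field_simp
      norm_num
      ring
    rw [e, norm_neg, norm_mul, norm_inv, Complex.norm_real, Real.norm_of_nonneg (by positivity),
      if_pos h1]
    gcongr
    refine (?_ : _ ≤ 1 / (m : ℝ) ^ 2).trans (le_add_of_nonneg_left (by positivity))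
    rw [one_div]
    apply inv_anti₀ (by positivity)
    exact le_mul_of_one_le_left (by positivity) (by nlinarith [Real.pi_gt_three])
  · have hl := inv_norm_Lam_le hn h0 h1
    have hne : Lam lam (m - n) ≠ 0 := Lam_ne_zero hn (by simpa using h0)
      (by intro h; apply h1; linarith)
    have hnc : (n : ℂ) ≠ 0 := by exact_mod_cast h0
    have hnc2 : (n : ℂ) - 2 * m ≠ 0 := by exact_mod_cast sub_ne_zero.mpr h1
    have hnc3 : 2 * (m : ℂ) - n ≠ 0 := by rw [← neg_sub]; exact neg_ne_zero.mpr hnc2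
    have hd := Lam_sub_Lam lam (m - n) m
    push_cast at hd
    have e : resCoef q m lam n - fourierCoef q n / (8 * Real.pi ^ 2 * m) *
        (1 / n - 1 / ((n - 2 * m : ℤ) : ℂ)) =
        -(fourierCoef q n * (Lam lam m * (Lam lam (m - n))⁻¹ *
          ((4 * Real.pi ^ 2 * (n * (2 * m - n)) : ℝ) : ℂ)⁻¹)) := by
      rw [resCoef, if_neg (by tauto)]
      have e1 : fourierCoef q n / (8 * Real.pi ^ 2 * m) * (1 / n - 1 / ((n - 2 * m : ℤ) : ℂ)) =
          fourierCoef q n * ((4 * Real.pi ^ 2 * (n * (2 * m - n)) : ℝ) : ℂ)⁻¹ := by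
        push_cast
        rw [div_sub_div _ _ hnc hnc2, show 1 * ((n : ℂ) - 2 * m) - n * 1 = -(2 * m) by ring,
          show 2 * (m : ℂ) - n = -(n - 2 * m) by ring]
        generalize (n : ℂ) - 2 * m = d at hnc2
        field_simp
        norm_num
        ring
      rw [e1]
      push_cast
      field_simp
      linear_combination -(fourierCoef q n) * hd
    rw [e, norm_neg, norm_mul, norm_mul, norm_mul, norm_inv, norm_inv, Complex.norm_real,
      if_neg h1, add_zero]
    have h4 : ‖4 * Real.pi ^ 2 * (n * (2 * m - n))‖⁻¹ ≤ wt (2 * m) n := by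
      have a : 0 < |(n : ℝ)| := abs_pos.mpr (by exact_mod_cast h0)
      have b : 0 < |(2 * m - n : ℝ)| := abs_pos.mpr (by
        exact_mod_cast sub_ne_zero.mpr (Ne.symm h1))
      unfold wt
      push_cast
      rw [norm_mul, norm_mul (n : ℝ), Real.norm_of_nonneg (by positivity : 0 ≤ 4 * Real.pi ^ 2)]
      apply inv_anti₀ (by positivity)
      exact le_mul_of_one_le_left (by positivity) (by nlinarith [Real.pi_gt_three])
    have := wt_nonneg (2 * m) n
    rw [show L * wt (2 * m) n ^ 2 = L * wt (2 * m) n * wt (2 * m) n by ring]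
    gcongr

theorem norm_resFun_sub_resMain_le (hm : 1 ≤ m) (hq : IntervalIntegrable q volume 0 1)
    (hq0 : fourierCoef q 0 = 0) (hn : ∀ n : ℤ, ‖Lam lam m‖ ≤ ‖Lam lam n‖) {L K : ℝ}
    (hL : ‖Lam lam m‖ ≤ L) (hs : Summable (wt (2 * m)))
    (hs2 : Summable fun n => wt (2 * m) n ^ 2) (hK : ∑' n, wt (2 * m) n ^ 2 ≤ K / (m : ℝ) ^ 2)
    {x : ℝ} (hx : x ∈ Icc (0 : ℝ) 1) :
    ‖resFun q m lam x - resMain q m x‖ ≤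
      (∫ x in (0 : ℝ)..1, ‖q x‖) * (L * K + 1) / (m : ℝ) ^ 2 := by
  have hA : 0 ≤ ∫ x in (0 : ℝ)..1, ‖q x‖ :=
    intervalIntegral.integral_nonneg zero_le_one fun x _ => norm_nonneg _
  have hL0 : 0 ≤ L := (norm_nonneg _).trans hL
  have hb := ((hs2.hasSum.mul_left L).add
    (hasSum_ite_eq (2 * m : ℤ) (1 / (m : ℝ) ^ 2))).mul_left (∫ x in (0 : ℝ)..1, ‖q x‖)
  have hd := norm_resCoef_sub_le hm hq hq0 hn hL
  have sa : Summable (resCoef q m lam) := (summable_norm_resCoef hn hs).of_norm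
  have sv : Summable (fourierCoef (resMain q m)) := by
    simpa using sa.sub (.of_norm_bounded hb.summable hd)
  have h01 : resMain q m 0 = resMain q m 1 := by
    simp only [resMain, wave_zero_right, wave_one_right, prim_zero_eq_prim_one hq,
      prim_zero_eq_prim_one (IntervalIntegrable.wave_mul hq (-(2 * m)))]
  have h1 := hasSum_fourierCoef (continuousOn_resMain (m := m) hq) h01 sv hx
  have h2 : Summable fun n => resCoef q m lam n * wave n x :=
    .of_norm (by simpa [norm_wave] using summable_norm_resCoef hn hs)
  rw [resFun, ← h1.tsum_eq, ← h2.tsum_sub h1.summable]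
  refine (tsum_of_norm_bounded hb fun n => ?_).trans ?_
  · rw [← sub_mul, norm_mul, norm_wave, mul_one]; exact hd n
  · rw [mul_div_assoc, add_div, mul_div_assoc]
    gcongr

/-- Q² has derivative 2Qq because q₀ = 0. With |Q| ≤ 4A, the endpoint term gives 16A² and the
derivative 8A². -/
theorem norm_integral_prim_sq_mul_le (hq : IntervalIntegrable q volume 0 1)
    (hq0 : fourierCoef q 0 = 0) :
    ‖∫ x in (0 : ℝ)..1, (prim q x * prim q x) * (wave (-(2 * m)) x * q x)‖ ≤
      24 * (∫ x in (0 : ℝ)..1, ‖q x‖) ^ 2 * rho q m := by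
  set A := ∫ x in (0 : ℝ)..1, ‖q x‖
  have hA : 0 ≤ A := intervalIntegral.integral_nonneg zero_le_one fun x _ => norm_nonneg _
  have hp : ∀ x ∈ Icc (0 : ℝ) 1, ‖prim q x‖ ≤ 4 * A := fun x hx =>
    norm_prim_le hq (fun x hx => by simpa using norm_integral_wave_mul_le hq 0 hx) hx
  have hac := absolutelyContinuous_prim hq
  have hd : ∀ᵐ x, x ∈ Ioo (0 : ℝ) 1 → HasDerivAt (prim q) (q x) x := by
    simpa [hq0] using ae_hasDerivAt_prim hq
  have i1 : IntervalIntegrable (fun x => 2 * (prim q x * q x)) volume 0 1 :=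
    (hq.continuousOn_mul hac.continuousOn).const_mul 2
  refine (norm_integral_mul_le_of_norm_primitive_le (f' := fun x => 2 * (prim q x * q x))
    (AbsolutelyContinuousOnInterval.mul_complex hac hac) ?_ i1
    (IntervalIntegrable.wave_mul hq _) fun x hx => norm_integral_le_rho hq m hx).trans ?_
  · filter_upwards [hd] with x hx h
    convert! (hx h).mul (hx h) using 1
    ring
  · refine mul_le_mul_of_nonneg_right ?_ (rho_nonneg q m)
    have h1 : ‖prim q 1 * prim q 1‖ ≤ (4 * A) * (4 * A) := by
      rw [norm_mul]
      exact mul_le_mul (hp 1 (by simp)) (hp 1 (by simp)) (norm_nonneg _) (by positivity)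
    have h2 : ∫ x in (0 : ℝ)..1, ‖2 * (prim q x * q x)‖ ≤ 8 * A * A := by
      rw [← intervalIntegral.integral_const_mul]
      refine intervalIntegral.integral_mono_on zero_le_one i1.norm (hq.norm.const_mul _)
        fun x hx => ?_
      rw [norm_mul, norm_mul, Complex.norm_ofNat]
      nlinarith [mul_le_mul_of_nonneg_right (hp x hx) (norm_nonneg (q x))]
    nlinarith

theorem exists_norm_b₂_le (hq : IntervalIntegrable q volume 0 1) (hq0 : fourierCoef q 0 = 0)
    {c : ℝ} (hc : 0 < c) {L : ℝ} (hL0 : 0 ≤ L) :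
    ∃ C : ℝ, ∀ m : ℕ, 1 ≤ m → c / m ≤ rho q m → ∀ lam : ℂ,
      (∀ n : ℤ, ‖Lam lam m‖ ≤ ‖Lam lam n‖) → ‖Lam lam m‖ ≤ L →
      ‖b₂ q m lam‖ ≤ C * (rho q m / (m : ℝ) ^ 2) := by
  obtain ⟨K, hK0, hK⟩ := exists_tsum_wt_le
  set A := ∫ x in (0 : ℝ)..1, ‖q x‖ with hAdef
  have hA : 0 ≤ A := intervalIntegral.integral_nonneg zero_le_one fun x _ => norm_nonneg _
  set E := A * (L * K + 1)
  have hE : 0 ≤ E := by positivity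
  -- The 4 comes from the sup bound for the primitive of q e^{-i4mπx}; E/c converts the error E/m²
  -- into a multiple of ρ(m)/m.
  set D := 4 + E / c
  have hD : 0 ≤ D := by positivity
  refine ⟨24 * A ^ 2 + (8 * A + D * A) * D * A, fun m hm hcm lam hn hL => ?_⟩
  obtain ⟨hs, -, hs2, hK2⟩ := hK m hm (2 * m) (abs_of_nonneg (by positivity))
  have hm1 : (1 : ℝ) ≤ m := by exact_mod_cast hm
  have hm0 : (0 : ℝ) < m := by linarith
  have hr0 := rho_nonneg q m
  have hrA := rho_le hq m
  rw [← hAdef] at hrA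
  set r := rho q m
  set κ : ℂ := Complex.I / (4 * Real.pi * m) with hκdef
  have hκ : ‖κ‖ ≤ 1 / m := by
    simp only [hκdef, norm_div, norm_mul, Complex.norm_I, Complex.norm_ofNat, Complex.norm_real,
      Complex.norm_natCast]
    rw [Real.norm_of_nonneg Real.pi_pos.le]
    gcongr
    exact le_mul_of_one_le_left hm0.le (by linarith [Real.pi_gt_three])
  set g : ℝ → ℂ := fun t => wave (-(2 * m)) t * q t
  have hg : IntervalIntegrable g volume 0 1 := IntervalIntegrable.wave_mul hq _
  set u := resFun q m lam
  set u₁ : ℝ → ℂ := fun x => κ * prim q x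
  have hp : ∀ x ∈ Icc (0 : ℝ) 1, ‖prim q x‖ ≤ 4 * A := fun x hx =>
    norm_prim_le hq (fun x hx => by simpa using norm_integral_wave_mul_le hq 0 hx) hx
  have hpg : ∀ x ∈ Icc (0 : ℝ) 1, ‖prim g x‖ ≤ 4 * r := fun x hx =>
    norm_prim_le hg (fun x hx => norm_integral_le_rho hq m hx) hx
  have hu₁ : ∀ x ∈ Icc (0 : ℝ) 1, ‖u₁ x‖ ≤ 4 * A / m := by
    intro x hx
    simp only [u₁, norm_mul]
    calc ‖κ‖ * ‖prim q x‖ ≤ 1 / m * (4 * A) := by gcongr; exact hp x hx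
      _ = _ := by ring
  have hu₂ : ∀ x ∈ Icc (0 : ℝ) 1, ‖u x - u₁ x‖ ≤ D * r / m := by
    intro x hx
    have e : u x - u₁ x = (u x - resMain q m x) - κ * (wave (2 * m) x * prim g x) := by
      simp only [u₁, resMain, κ, g]; ring
    rw [e]
    refine (norm_sub_le _ _).trans ?_
    have h1 : ‖u x - resMain q m x‖ ≤ E / (m : ℝ) ^ 2 :=
      norm_resFun_sub_resMain_le hm hq hq0 hn hL hs hs2 hK2 hx
    have h2 : ‖κ * (wave (2 * m) x * prim g x)‖ ≤ 1 / m * (4 * r) := by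
      rw [norm_mul, norm_mul, norm_wave, one_mul]; gcongr; exact hpg x hx
    have h3 : E / (m : ℝ) ^ 2 ≤ E / c * r / m := by
      have := mul_le_mul_of_nonneg_left hcm (by positivity : 0 ≤ E / c / m)
      calc E / (m : ℝ) ^ 2 = E / c / m * (c / m) := by field_simp
        _ ≤ _ := this
        _ = _ := by ring
    calc _ ≤ E / c * r / m + 1 / m * (4 * r) := add_le_add (h1.trans h3) h2
      _ = D * r / m := by simp only [D]; ring
  have hcu : ContinuousOn u (uIcc 0 1) := (continuous_resFun hn hs).continuousOn
  have hcu₁ : ContinuousOn u₁ (uIcc 0 1) :=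
    continuousOn_const.mul (absolutelyContinuous_prim hq).continuousOn
  have i1 : IntervalIntegrable (fun x => κ ^ 2 * ((prim q x * prim q x) * g x)) volume 0 1 :=
    (hg.continuousOn_mul ((absolutelyContinuous_prim hq).continuousOn.mul
      (absolutelyContinuous_prim hq).continuousOn)).const_mul _
  have i2 : IntervalIntegrable (fun x => (2 * u₁ x + (u x - u₁ x)) * (u x - u₁ x) * g x)
      volume 0 1 := hg.continuousOn_mul (by fun_prop)
  -- Here u² = u₁² + (2u₁ + (u - u₁))(u - u₁); only the first term needs the oscillation of `g`.
  have e : b₂ q m lam = κ ^ 2 * (∫ x in (0 : ℝ)..1, (prim q x * prim q x) * g x) +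
      ∫ x in (0 : ℝ)..1, (2 * u₁ x + (u x - u₁ x)) * (u x - u₁ x) * g x := by
    rw [b₂_eq_fourierCoef hq hq0 hn hs, fourierCoef_eq, ← intervalIntegral.integral_const_mul,
      ← intervalIntegral.integral_add i1 i2]
    congr 1; ext x
    simp only [u₁, g, u]
    ring
  have b1 : ‖κ ^ 2 * (∫ x in (0 : ℝ)..1, (prim q x * prim q x) * g x)‖ ≤
      (1 / m) ^ 2 * (24 * A ^ 2 * r) := by
    rw [norm_mul, norm_pow]
    gcongr
    exact norm_integral_prim_sq_mul_le hq hq0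
  have b2 : ‖∫ x in (0 : ℝ)..1, (2 * u₁ x + (u x - u₁ x)) * (u x - u₁ x) * g x‖ ≤
      (2 * (4 * A / m) + D * A / m) * (D * r / m) * A := by
    refine (intervalIntegral.norm_integral_le_integral_norm zero_le_one).trans ?_
    rw [hAdef, ← intervalIntegral.integral_const_mul]
    refine intervalIntegral.integral_mono_on zero_le_one i2.norm (hq.norm.const_mul _)
      fun x hx => ?_
    have hgx : ‖g x‖ = ‖q x‖ := by simp only [g, norm_mul, norm_wave, one_mul]
    rw [norm_mul, norm_mul, hgx]
    have h1 : ‖2 * u₁ x + (u x - u₁ x)‖ ≤ 2 * (4 * A / m) + D * A / m := by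
      refine (norm_add_le _ _).trans (add_le_add ?_ ((hu₂ x hx).trans (by gcongr)))
      rw [norm_mul, Complex.norm_ofNat]
      gcongr
      exact hu₁ x hx
    gcongr
    exact hu₂ x hx
  rw [e]
  refine (norm_add_le _ _).trans ((add_le_add b1 b2).trans_eq ?_)
  field_simp
  ring

end

/-! ### Conjugation symmetry between b₂ and b'₂ -/

theorem Lam_conj (lam : ℂ) (n : ℤ) :
    Lam ((starRingEnd ℂ) lam) n = (starRingEnd ℂ) (Lam lam n) := by
  simp only [Lam, map_sub, Complex.conj_ofReal]

theorem b₂'_eq_conj (q : ℝ → ℂ) (m : ℕ) (lam : ℂ) :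
    b₂' q m lam =
      (starRingEnd ℂ) (b₂ (fun x => (starRingEnd ℂ) (q x)) m ((starRingEnd ℂ) lam)) := by
  rw [b₂', b₂, tsum_subtype (idx₂ (-2 * m)) (b₂Term' q m lam), tsum_subtype (idx₂ (2 * m)),
    Complex.conj_tsum, ← (Equiv.neg (ℤ × ℤ)).tsum_eq]
  congr 1; ext ⟨p₁, p₂⟩
  have hmem : (Equiv.neg (ℤ × ℤ)) (p₁, p₂) ∈ idx₂ (-2 * m) ↔ (p₁, p₂) ∈ idx₂ (2 * m) := by
    simp only [idx₂, mem_ofPred_eq, Equiv.neg_apply, Prod.neg_mk, ne_eq]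
    omega
  by_cases h : (p₁, p₂) ∈ idx₂ (2 * (m : ℤ))
  · rw [indicator_of_mem (hmem.mpr h), indicator_of_mem h]
    simp only [b₂Term, b₂Term', Equiv.neg_apply, Prod.neg_mk, fourierCoef_conj, Lam_conj, map_div₀,
      map_mul, Complex.conj_conj]
    ring_nf
  · rw [indicator_of_notMem (mt hmem.mp h), indicator_of_notMem h, map_zero]

/-! ### Termwise bounds by products of weights -/

section

variable {q : ℝ → ℂ} {m : ℕ} {lam : ℂ}

theorem norm_b₂Term_le (hn : ∀ n : ℤ, ‖Lam lam m‖ ≤ ‖Lam lam n‖) {A : ℝ}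
    (hA : ∀ n, ‖fourierCoef q n‖ ≤ A) : ∀ p ∈ idx₂ (2 * m),
      ‖b₂Term q m lam p‖ ≤ A ^ 3 * (wt (2 * m) p.1 * wt (2 * m) (p.1 + p.2)) := by
  rintro ⟨a, b⟩ ⟨h1, -, h2, h3, h4⟩
  have hA0 : 0 ≤ A := (norm_nonneg _).trans (hA 0)
  have i1 := inv_norm_Lam_le hn h1 h2
  have i2 := inv_norm_Lam_le hn h3 h4
  have := wt_nonneg (2 * m) a
  simp only [b₂Term, norm_mul, norm_inv, div_eq_mul_inv, mul_inv, sub_sub] at *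
  rw [pow_succ, sq]
  gcongr <;> apply hA

theorem norm_b₂Term'_le (hn : ∀ n : ℤ, ‖Lam lam m‖ ≤ ‖Lam lam n‖) {A : ℝ}
    (hA : ∀ n, ‖fourierCoef q n‖ ≤ A) : ∀ p ∈ idx₂ (-2 * m),
      ‖b₂Term' q m lam p‖ ≤ A ^ 3 * (wt (-2 * m) p.1 * wt (-2 * m) (p.1 + p.2)) := by
  rintro ⟨a, b⟩ ⟨h1, -, h2, h3, h4⟩
  have hA0 : 0 ≤ A := (norm_nonneg _).trans (hA 0)
  have i1 := inv_norm_Lam_le' hn h1 h2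
  have i2 := inv_norm_Lam_le' hn h3 h4
  have := wt_nonneg (-2 * m) a
  simp only [b₂Term', norm_mul, norm_inv, div_eq_mul_inv, mul_inv, add_assoc] at *
  rw [pow_succ, sq]
  gcongr <;> apply hA

theorem norm_R₂Term_le {Ψ : ℝ → ℂ} (hn : ∀ n : ℤ, ‖Lam lam m‖ ≤ ‖Lam lam n‖) {A B : ℝ}
    (hA : ∀ n, ‖fourierCoef q n‖ ≤ A) (hB : ∀ n, ‖fourierCoef (fun x => q x * Ψ x) n‖ ≤ B) :
    ∀ p ∈ idx₃ (2 * m), ‖R₂Term q m lam Ψ p‖ ≤ A ^ 3 * B *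
      (wt (2 * m) p.1 * (wt (2 * m) (p.1 + p.2.1) * wt (2 * m) (p.1 + p.2.1 + p.2.2))) := by
  rintro ⟨a, b, c⟩ ⟨h1, -, -, h2, h3, h4, h5, h6⟩
  have hA0 : 0 ≤ A := (norm_nonneg _).trans (hA 0)
  have hB0 : 0 ≤ B := (norm_nonneg _).trans (hB 0)
  have i1 := inv_norm_Lam_le hn h1 h2
  have i2 := inv_norm_Lam_le hn h3 h4
  have i3 := inv_norm_Lam_le hn h5 h6
  have := wt_nonneg (2 * m) a
  have := wt_nonneg (2 * m) (a + b)
  have e : (m : ℤ) - (a + b) - c = m - (a + b + c) := by ring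
  have e' : (m : ℤ) - a - b = m - (a + b) := by ring
  simp only [R₂Term, norm_div, norm_mul, e, e']
  rw [div_eq_mul_inv, mul_inv, mul_inv, mul_assoc (_⁻¹), pow_succ, sq]
  gcongr <;> first | apply hA | apply hB

theorem norm_R₂Term'_le {Ψ : ℝ → ℂ} (hn : ∀ n : ℤ, ‖Lam lam m‖ ≤ ‖Lam lam n‖) {A B : ℝ}
    (hA : ∀ n, ‖fourierCoef q n‖ ≤ A) (hB : ∀ n, ‖fourierCoef (fun x => q x * Ψ x) n‖ ≤ B) :
    ∀ p ∈ idx₃ (-2 * m), ‖R₂Term' q m lam Ψ p‖ ≤ A ^ 3 * B *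
      (wt (-2 * m) p.1 * (wt (-2 * m) (p.1 + p.2.1) * wt (-2 * m) (p.1 + p.2.1 + p.2.2))) := by
  rintro ⟨a, b, c⟩ ⟨h1, -, -, h2, h3, h4, h5, h6⟩
  have hA0 : 0 ≤ A := (norm_nonneg _).trans (hA 0)
  have hB0 : 0 ≤ B := (norm_nonneg _).trans (hB 0)
  have i1 := inv_norm_Lam_le' hn h1 h2
  have i2 := inv_norm_Lam_le' hn h3 h4
  have i3 := inv_norm_Lam_le' hn h5 h6
  have := wt_nonneg (-2 * m) a
  have := wt_nonneg (-2 * m) (a + b)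
  have e : (m : ℤ) + (a + b) + c = m + (a + b + c) := by ring
  have e' : (m : ℤ) + a + b = m + (a + b) := by ring
  simp only [R₂Term', norm_div, norm_mul, e, e']
  rw [div_eq_mul_inv, mul_inv, mul_inv, mul_assoc (_⁻¹), pow_succ, sq]
  gcongr <;> first | apply hA | apply hB

end

/-! ### Choice of constants and conclusion -/

theorem pow_three_le_of_le_rpow {S K : ℝ} {m : ℕ} (hS : 0 ≤ S)
    (h : S ≤ K * (m : ℝ) ^ (-(2 / 3) : ℝ)) : S ^ 3 ≤ K ^ 3 / (m : ℝ) ^ 2 := by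
  refine (pow_le_pow_left₀ hS h 3).trans_eq ?_
  rw [mul_pow, ← Real.rpow_natCast ((m : ℝ) ^ (-(2 / 3) : ℝ)), ← Real.rpow_mul (by positivity),
    show (-(2 / 3) : ℝ) * (3 : ℕ) = -(2 : ℕ) by norm_num, Real.rpow_neg (by positivity),
    Real.rpow_natCast, div_eq_mul_inv]

/-- The bounds on `b₂`, `b'₂`, `R₂`, `R'₂`, with the constant chosen before the threshold for `m`. -/
theorem exists_bound {q : ℝ → ℂ} (hq : IntervalIntegrable q volume 0 1)
    (hq0 : fourierCoef q 0 = 0) {L B K : ℝ} (hL : 0 ≤ L) (hB : 0 ≤ B) (hK : 0 ≤ K) :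
    ∃ C : ℝ, ∀ m : ℕ, 1 ≤ m → ∀ lam : ℂ, (∀ n : ℤ, ‖Lam lam m‖ ≤ ‖Lam lam n‖) → ‖Lam lam m‖ ≤ L →
      ‖b₂ q m lam‖ ≤ C * (rho q m / (m : ℝ) ^ 2) ∧ ‖b₂' q m lam‖ ≤ C * (rho q m / (m : ℝ) ^ 2) ∧
      ∀ Ψ : ℝ → ℂ,
        (‖R₂ q m lam Ψ‖ ≤ B * (K / (m : ℝ) ^ 2) → ‖R₂ q m lam Ψ‖ ≤ C * (rho q m / (m : ℝ))) ∧
        (‖R₂' q m lam Ψ‖ ≤ B * (K / (m : ℝ) ^ 2) → ‖R₂' q m lam Ψ‖ ≤ C * (rho q m / (m : ℝ))) := by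
  -- If every coefficient of q vanishes, there is no lower bound c/m for ρ(m), but all four series
  -- are zero.
  by_cases hz : ∀ n, fourierCoef q n = 0
  · refine ⟨0, fun m _ lam _ _ => ?_⟩
    simp [b₂, b₂', R₂, R₂', b₂Term, b₂Term', R₂Term, R₂Term', hz]
  push Not at hz
  obtain ⟨n, hn⟩ := hz
  obtain ⟨c, hc, hcm⟩ := exists_div_le_rho hq hn
  have hqc : IntervalIntegrable (fun x => (starRingEnd ℂ) (q x)) volume 0 1 := by
    rw [intervalIntegrable_iff] at hq ⊢
    exact (LinearIsometryEquiv.integrable_comp_iff Complex.conjLIE).mpr hq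
  obtain ⟨C₁, h₁⟩ := exists_norm_b₂_le hq hq0 hc hL
  obtain ⟨C₂, h₂⟩ := exists_norm_b₂_le hqc (by rw [fourierCoef_conj]; simp [hq0]) hc hL
  refine ⟨|C₁| + |C₂| + B * K / c, fun m hm lam hlam hlamL => ?_⟩
  have hm0 : (0 : ℝ) < m := by exact_mod_cast hm
  have hr := rho_nonneg q m
  have hbk : 0 ≤ B * K / c := by positivity
  have hR : B * (K / (m : ℝ) ^ 2) ≤ (|C₁| + |C₂| + B * K / c) * (rho q m / m) := by
    calc B * (K / (m : ℝ) ^ 2) = B * K / c * ((c / m) / m) := by field_simp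
      _ ≤ B * K / c * (rho q m / m) := by gcongr; exact hcm m hm
      _ ≤ _ := by
        gcongr
        exact le_add_of_nonneg_left (by positivity)
  refine ⟨(h₁ m hm (hcm m hm) lam hlam hlamL).trans ?_, ?_,
    fun Ψ => ⟨fun h => h.trans hR, fun h => h.trans hR⟩⟩
  · gcongr
    linarith [le_abs_self C₁, abs_nonneg C₂]
  · rw [b₂'_eq_conj, RCLike.norm_conj]
    have := h₂ m hm (by rw [rho_conj]; exact hcm m hm) ((starRingEnd ℂ) lam)
      (by simpa only [Lam_conj, RCLike.norm_conj] using hlam)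
      (by simpa only [Lam_conj, RCLike.norm_conj] using hlamL)
    rw [rho_conj] at this
    refine this.trans ?_
    gcongr
    linarith [le_abs_self C₂, abs_nonneg C₁]

end Hill

theorem lemma3 (q : ℝ → ℂ) (hq : IntervalIntegrable q volume 0 1)
    (hq0 : Hill.fourierCoef q 0 = 0) :
    ∃ (C : ℝ) (N : ℕ), ∀ m : ℕ, N ≤ m → ∀ lam : ℂ, Hill.IsEigenvalueOfIndex q m lam →
      (∀ n : ℤ, n ≠ m → n ≠ -m → Hill.Lam lam n ≠ 0) ∧
      (Summable fun p : Hill.idx₂ (2 * m) => Hill.b₂Term q m lam p) ∧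
      (Summable fun p : Hill.idx₂ (-2 * m) => Hill.b₂Term' q m lam p) ∧
      ‖Hill.b₂ q m lam‖ ≤ C * (Hill.rho q m / (m : ℝ) ^ 2) ∧
      ‖Hill.b₂' q m lam‖ ≤ C * (Hill.rho q m / (m : ℝ) ^ 2) ∧
      ∀ Ψ : ℝ → ℂ, Hill.IsNormalizedEigenfunction q lam Ψ →
        (Summable fun p : Hill.idx₃ (2 * m) => Hill.R₂Term q m lam Ψ p) ∧
        (Summable fun p : Hill.idx₃ (-2 * m) => Hill.R₂Term' q m lam Ψ p) ∧
        ‖Hill.R₂ q m lam Ψ‖ ≤ C * (Hill.rho q m / (m : ℝ)) ∧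
        ‖Hill.R₂' q m lam Ψ‖ ≤ C * (Hill.rho q m / (m : ℝ)) := by
  open Hill in
  obtain ⟨K, hK0, hK⟩ := exists_tsum_wt_le
  set A := ∫ x in (0 : ℝ)..1, ‖q x‖ with hAdef
  have hA : 0 ≤ A := intervalIntegral.integral_nonneg zero_le_one fun x _ => norm_nonneg _
  obtain ⟨C, hC⟩ := exists_bound hq hq0 (L := 4 * A) (B := A ^ 3 * (A * 4)) (K := K ^ 3)
    (by positivity) (by positivity) (by positivity)
  -- This limit fixes the threshold beyond which A times the weight sum is at most 1/2, as
  -- absorption requires.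
  have hlim : Filter.Tendsto (fun m : ℕ => A * (K * (m : ℝ) ^ (-(2 / 3) : ℝ))) Filter.atTop
      (nhds (A * (K * 0))) :=
    (((tendsto_rpow_neg_atTop (by norm_num)).comp tendsto_natCast_atTop_atTop).const_mul K).const_mul A
  obtain ⟨N, hN⟩ := Filter.eventually_atTop.mp
    (hlim.eventually (gt_mem_nhds (by norm_num : A * (K * 0) < 1 / 2)))
  refine ⟨C, max N 1, fun m hm lam ⟨hev, hn⟩ => ?_⟩
  have hm1 : 1 ≤ m := (le_max_right _ _).trans hm
  obtain ⟨hs, hle, -, -⟩ := hK m hm1 (2 * m) (abs_of_nonneg (by positivity))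
  obtain ⟨hs', hle', -, -⟩ := hK m hm1 (-2 * m) (by
    rw [neg_mul, abs_neg]; exact abs_of_nonneg (by positivity))
  have hsmall : A * ∑' k, wt (2 * m) k ≤ 1 / 2 :=
    (mul_le_mul_of_nonneg_left hle hA).trans (hN m ((le_max_left _ _).trans hm)).le
  obtain ⟨hb, hb', hR⟩ := hC m hm1 lam hn (hev.norm_Lam_le hq hn hs hsmall)
  have hqA := norm_fourierCoef_le q
  refine ⟨fun n h1 h2 => Lam_ne_zero hn h1 h2,
    summable_subtype_of_le_mul₂ (wt_nonneg _) hs (norm_b₂Term_le hn hqA),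
    summable_subtype_of_le_mul₂ (wt_nonneg _) hs' (norm_b₂Term'_le hn hqA), hb, hb', fun Ψ hΨ => ?_⟩
  have hqΨ := hΨ.norm_fourierCoef_mul_le hq hn hs hsmall
  have hB : 0 ≤ A ^ 3 * (A * 4) := by positivity
  obtain ⟨s, hle₃⟩ := summable_and_norm_tsum_le_of_le_mul₃ (wt_nonneg _) hs hB
    (norm_R₂Term_le hn hqA hqΨ)
  obtain ⟨s', hle₃'⟩ := summable_and_norm_tsum_le_of_le_mul₃ (wt_nonneg _) hs' hB
    (norm_R₂Term'_le hn hqA hqΨ)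
  exact ⟨s, s', (hR Ψ).1 (hle₃.trans (mul_le_mul_of_nonneg_left
      (pow_three_le_of_le_rpow (tsum_nonneg (wt_nonneg _)) hle) hB)),
    (hR Ψ).2 (hle₃'.trans (mul_le_mul_of_nonneg_left
      (pow_three_le_of_le_rpow (tsum_nonneg (wt_nonneg _)) hle') hB))⟩
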